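/- Let $E$ be a locally compact metric space with its Borel $\sigma$-field, and let $(X_t)_{t\ge 0}$ be a (time-homogeneous, conservative) Markov process with right-continuous paths in $E$ on $(\Omega,\mathcal F,(\mathcal F_t))$, with laws $\mathbb P^x$, $x\in E$ (so $\mathbb P^x(X_0=x)=1$ and $\mathbb P^x(X_{s+t}\in B\mid\mathcal F_s)=\mathbb P^{X_s}(X_t\in B)$). Let $f:E\to\mathbb R$ be bounded and continuous, let $g:E\to\mathbb R$ be continuous (possibly unbounded), and put, for $t\ge 0$, $x\in E$, $n\in\mathbb N$, $$w_t(x)=\sup_{\tau\le t}\mathbb E^x\Big[\int_0^\tau f(X_s)\,ds+g(X_\tau)\Big],\qquad \hat w^n_t(x)=\sup_{\tau\le t}\mathbb E^x\Big[\int_0^\tau f(X_s)\,ds+\big(g(X_\tau)\vee(-n)\big)\wedge n\Big],$$ the suprema being over $(\mathcal F_t)$-stopping times. Fix $T\ge 0$, let $\zeta_T=\sup_{t\in[0,T]}|g(X_t)|$, and assume $(B)_T$: for every $x\in E$ there is a compact ball $K=\bar B(x,\delta)$, $\delta>0$, such that $$\lim_{n\to\infty}\ \sup_{y\in K}\mathbb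 E^y\big[\zeta_T\mathbf 1_{\{\zeta_T>n\}}\big]=0.$$ Then, for $t\in[0,T]$ and $x\in E$, all the expectations in the definition of $w_t(x)$ exist and $w_t(x)$ is finite, and for every compact ball $K$ as in $(B)_T$, $\hat w^n_t(x)\to w_t(x)$ as $n\to\infty$, uniformly in $(t,x)\in[0,T]\times K$. If, in addition, $E$ is separable and the process is weakly Feller, i.e. (A1) $P_t\,\mathcal C_0\subseteq\mathcal C_0$ for all $t\ge 0$, where $P_t\varphi(x)=\mathbb E^x[\varphi(X_t)]$ and $\mathcal C_0$ is the space of continuous functions $E\to\mathbb R$ vanishing at infinity, then $(t,x)\mapsto w_t(x)$ is continuous on $[0,T]\times E$. -/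

import Mathlib

open Set Filter Topology MeasureTheory ProbabilityTheory
open scoped NNReal ENNReal ZeroAtInfty

noncomputable section

/-- A (conservative, time-homogeneous) Markov process with right-continuous paths in a metric
space `E`, given by a filtered space `(Ω, F, (F_t))`, an adapted process `X` and the family
`P x` of laws of the process started from `x`. The filtration may be larger than the one
generated by `X`. -/
structure MarkovProcess (E Ω : Type*) [MetricSpace E] [MeasurableSpace E]
    [mΩ : MeasurableSpace Ω] where
  /-- the filtration `(F_t)` -/
  filtration : Filtration ℝ≥0 mΩ
  /-- the process `(X_t)` -/
  X : ℝ≥0 → Ω → E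
  /-- the laws `P^x` -/
  P : E → Measure Ω
  isProbabilityMeasure : ∀ x, IsProbabilityMeasure (P x)
  adapted : ∀ t, Measurable[filtration t] (X t)
  rightContinuous : ∀ ω t, ContinuousWithinAt (fun s => X s ω) (Ici t) t
  initial : ∀ x, ∀ᵐ ω ∂(P x), X 0 ω = x
  /-- for a Borel set `B`, the transition probability `P_t(x, B) = P^x(X_t ∈ B)` is Borel in `x` -/
  measurable_transition : ∀ t (B : Set E), MeasurableSet B →
    Measurable fun x => P x (X t ⁻¹' B)
  /-- the Markov property `P^x(X_{s+t} ∈ B | F_s) = P_t(X_s, B)`, integrated over `A ∈ F_s` -/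
  markov : ∀ x s t (A : Set Ω) (B : Set E), MeasurableSet[filtration s] A → MeasurableSet B →
    P x (A ∩ X (s + t) ⁻¹' B) = ∫⁻ ω in A, P (X s ω) (X t ⁻¹' B) ∂(P x)

namespace MarkovProcess

variable {E Ω : Type*} [MetricSpace E] [MeasurableSpace E] [MeasurableSpace Ω]

/-- The weak Feller property: `P_t C_0 ⊆ C_0` for every `t ≥ 0`, where
`P_t φ (x) = E^x[φ(X_t)]`. -/
def WeakFeller (M : MarkovProcess E Ω) : Prop :=
  ∀ (t : ℝ≥0) (φ : C₀(E, ℝ)), ∃ ψ : C₀(E, ℝ), ∀ x, ψ x = ∫ ω, φ (M.X t ω) ∂(M.P x)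

/-- The stopping times `τ` with `τ ≤ t`. -/
def stoppingTimes (M : MarkovProcess E Ω) (t : ℝ≥0) : Set (Ω → ℝ≥0) :=
  {τ | IsStoppingTime M.filtration (fun ω => (τ ω : WithTop ℝ≥0)) ∧ ∀ ω, τ ω ≤ t}

/-- The random variable `∫_0^τ f(X_s) ds + g(X_τ)`. -/
def reward (M : MarkovProcess E Ω) (f g : E → ℝ) (τ : Ω → ℝ≥0) (ω : Ω) : ℝ :=
  (∫ s in (0 : ℝ)..(τ ω : ℝ), f (M.X s.toNNReal ω)) + g (M.X (τ ω) ω)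

/-- The set of all expected rewards `E^x[∫_0^τ f(X_s) ds + g(X_τ)]` over stopping times
`τ ≤ t`. -/
def expectedRewards (M : MarkovProcess E Ω) (f g : E → ℝ) (t : ℝ≥0) (x : E) : Set ℝ :=
  (fun τ => ∫ ω, M.reward f g τ ω ∂(M.P x)) '' M.stoppingTimes t

/-- The value function `w_t(x) = sup_{τ ≤ t} E^x[∫_0^τ f(X_s) ds + g(X_τ)]`. -/
def value (M : MarkovProcess E Ω) (f g : E → ℝ) (t : ℝ≥0) (x : E) : ℝ :=
  sSup (M.expectedRewards f g t x)

/-- The value function `ŵ^n_t(x)` with the truncated terminal reward `(g ∨ (-n)) ∧ n`. -/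
def truncatedValue (M : MarkovProcess E Ω) (f g : E → ℝ) (n : ℕ) (t : ℝ≥0) (x : E) : ℝ :=
  M.value f (fun y => min (max (g y) (-(n : ℝ))) (n : ℝ)) t x

/-- The random variable `ζ_T = sup_{t ∈ [0, T]} |g(X_t)|`, with values in `[0, ∞]`. -/
def runningSup (M : MarkovProcess E Ω) (g : E → ℝ) (T : ℝ≥0) (ω : Ω) : ℝ≥0∞ :=
  ⨆ t ∈ Icc 0 T, ENNReal.ofReal |g (M.X t ω)|

/-- `ζ_T` is uniformly integrable with respect to `P^y`, `y ∈ K`: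
`lim_{n → ∞} sup_{y ∈ K} E^y[ζ_T 1_{ζ_T > n}] = 0`. -/
def SupUniformlyIntegrableOn (M : MarkovProcess E Ω) (g : E → ℝ) (T : ℝ≥0) (K : Set E) : Prop :=
  Tendsto (fun n : ℕ => ⨆ y ∈ K,
    ∫⁻ ω in {ω | (n : ℝ≥0∞) < M.runningSup g T ω}, M.runningSup g T ω ∂(M.P y)) atTop (𝓝 0)

/-- `closedBall x δ` is a compact ball on which `ζ_T` is uniformly integrable. -/
def IsGoodBall (M : MarkovProcess E Ω) (g : E → ℝ) (T : ℝ≥0) (x : E) (δ : ℝ) : Prop :=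
  0 < δ ∧ IsCompact (Metric.closedBall x δ) ∧
    M.SupUniformlyIntegrableOn g T (Metric.closedBall x δ)

/-- Assumption `(B)_T`: every point is the centre of a compact ball on which `ζ_T` is uniformly
integrable. -/
def AssumptionB (M : MarkovProcess E Ω) (g : E → ℝ) (T : ℝ≥0) : Prop :=
  ∀ x : E, ∃ δ : ℝ, M.IsGoodBall g T x δ

end MarkovProcess

end

/-! Truncation. At a stopping time τ ≤ t ≤ T, cutting `g` off at level n changes g(X_τ) by at most
|g(X_τ)| on {|g(X_τ)| > n}, hence by at most ζ_T 1_{ζ_T > n}. This bound does not depend on τ, and a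
supremum is 1-Lipschitz in its family, so (B)_T makes ŵ^n - w small uniformly on [0,T] × K
(`tendstoUniformlyOn_truncatedValue`). The same tail estimate at one fixed level gives integrability
and finiteness. Uniform limits of continuous functions being continuous, joint continuity of w
reduces to bounded `g`.

Bounded rewards. A weakly Feller process is compactly contained at stopping times: `exists_cutoff`
gives a continuous χ vanishing at infinity with E^x[1 - χ(X_τ)] ≤ ε for all τ ≤ T and all x near x₀.
Replacing f, g by fχ, gχ costs O(ε) locally uniformly, and the new rewards extend continuously to
the one-point compactification.

Rewards on the compactification. There the transition operators Q_t form a Feller semigroup, and w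
is the uniform limit of dynamic programming values with n + 1 steps of length t/(n+1). These are
built from Q_t by continuous operations, so they are continuous in (t, x). The cost of rounding a
stopping time up to the grid is governed by E[(G(X_s) - G(X_{s+r}))² | F_s], which is Q_r(G²) - 2 G
Q_r G + G² evaluated at X_s and tends to 0 uniformly as r → 0.

Both facts rest on `strongly_continuous`. For excessive functions, convergence of Q_t u as t → 0 is
monotone up to a discount, hence uniform by Dini; differences of excessive functions form a vector
lattice that is dense by Stone–Weierstrass.

Only the Markov property at deterministic times enters: stopping times are approximated from the
right by ones with finitely many values, for which {τ = s} ∈ F_s, and right-continuity of paths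
gives the limit. Neither the strong Markov property nor a right-continuous filtration is needed. -/

noncomputable section

set_option linter.unusedSectionVars false

/-! ### Right-continuous processes -/

/-- The smallest element of the grid `{k h}` which is at least `s`. -/
def gridCeil (h s : ℝ≥0) : ℝ≥0 := (⌈s / h⌉₊ : ℝ≥0) * h

lemma le_gridCeil {h : ℝ≥0} (hh : h ≠ 0) (s : ℝ≥0) : s ≤ gridCeil h s := by
  have h1 : s / h ≤ (⌈s / h⌉₊ : ℝ≥0) := Nat.le_ceil _
  calc s = s / h * h := (div_mul_cancel₀ s hh).symm
    _ ≤ _ := by unfold gridCeil; gcongr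

lemma gridCeil_le_add (h s : ℝ≥0) : gridCeil h s ≤ s + h := by
  rcases eq_or_ne h 0 with rfl | hh
  · simp [gridCeil]
  · have h1 : (⌈s / h⌉₊ : ℝ≥0) ≤ s / h + 1 := (Nat.ceil_lt_add_one (zero_le)).le
    calc gridCeil h s ≤ (s / h + 1) * h := by unfold gridCeil; gcongr
      _ = s + h := by rw [add_mul, div_mul_cancel₀ s hh, one_mul]

lemma measurable_gridCeil (h : ℝ≥0) : Measurable (gridCeil h) := by
  unfold gridCeil
  exact (measurable_from_nat (f := fun k : ℕ => (k : ℝ≥0) * h)).comp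
    (Nat.measurable_ceil.comp (measurable_id.div_const h))

lemma tendsto_gridCeil {h : ℕ → ℝ≥0} (h0 : ∀ n, h n ≠ 0) (hl : Tendsto h atTop (𝓝 0)) (s : ℝ≥0) :
    Tendsto (fun n => gridCeil (h n) s) atTop (𝓝[≥] s) := by
  refine tendsto_nhdsWithin_iff.2 ⟨?_, Eventually.of_forall fun n => le_gridCeil (h0 n) s⟩
  refine tendsto_of_tendsto_of_tendsto_of_le_of_le tendsto_const_nhds ?_
    (fun n => le_gridCeil (h0 n) s) (fun n => gridCeil_le_add (h n) s)
  simpa using tendsto_const_nhds.add hl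

lemma tendsto_one_div_succ_nnreal :
    Tendsto (fun n : ℕ => (1 : ℝ≥0) / ((n : ℝ≥0) + 1)) atTop (𝓝 0) :=
  tendsto_one_div_add_atTop_nhds_zero_nat

/-- Freezing time at the next grid point leaves countably many measurable sections; as the mesh
shrinks, grid times approach from the right and right-continuity gives pointwise convergence. -/
lemma measurable_uncurry_of_rightContinuous {α : Type*} [MeasurableSpace α] {F : ℝ≥0 → α → ℝ}
    (hm : ∀ s, Measurable (F s)) (hc : ∀ a t, ContinuousWithinAt (fun s => F s a) (Ici t) t) :
    Measurable (Function.uncurry F) := by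
  let h : ℕ → ℝ≥0 := fun n => 1 / ((n : ℝ≥0) + 1)
  have h0 : ∀ n, h n ≠ 0 := fun n => by positivity
  refine measurable_of_tendsto_metrizable
    (f := fun (n : ℕ) (p : ℝ≥0 × α) => F (gridCeil (h n) p.1) p.2) (fun n => ?_) ?_
  · have h1 : Measurable (Function.uncurry fun (k : ℕ) (a : α) => F ((k : ℝ≥0) * h n) a) :=
      measurable_from_prod_countable_right fun k => hm ((k : ℝ≥0) * h n)
    exact h1.comp (f := fun p : ℝ≥0 × α => (⌈p.1 / h n⌉₊, p.2))
      ((Nat.measurable_ceil.comp (measurable_fst.div_const _)).prodMk measurable_snd)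
  · rw [tendsto_pi_nhds]
    rintro ⟨s, a⟩
    exact (hc a s).tendsto.comp (tendsto_gridCeil h0 tendsto_one_div_succ_nnreal s)

/-! ### Feller semigroups on a compact space -/

/-- A Markov semigroup on `C(Y, ℝ)`, `Y` compact, given by transition probabilities `κ t y` and
pointwise right-continuous in time. -/
structure FellerSemigroup (Y : Type*) [TopologicalSpace Y] [MeasurableSpace Y] where
  /-- the operators `Q_t` -/
  Q : ℝ≥0 → C(Y, ℝ) → C(Y, ℝ)
  /-- the transition probabilities -/
  κ : ℝ≥0 → Y → Measure Y
  prob : ∀ t y, IsProbabilityMeasure (κ t y)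
  apply_eq : ∀ t φ y, Q t φ y = ∫ z, φ z ∂κ t y
  zero : ∀ φ, Q 0 φ = φ
  add : ∀ s t φ, Q (s + t) φ = Q s (Q t φ)
  rightCont : ∀ φ y t, ContinuousWithinAt (fun s => Q s φ y) (Ici t) t

namespace FellerSemigroup

variable {Y : Type*} [TopologicalSpace Y] [CompactSpace Y] [MeasurableSpace Y]
  [OpensMeasurableSpace Y] (S : FellerSemigroup Y)

instance (t : ℝ≥0) (y : Y) : IsProbabilityMeasure (S.κ t y) := S.prob t y

lemma integrable (φ : C(Y, ℝ)) (μ : Measure Y) [IsFiniteMeasure μ] : Integrable φ μ :=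
  Integrable.of_bound φ.continuous.measurable.aestronglyMeasurable ‖φ‖
    (Eventually.of_forall φ.norm_coe_le_norm)

lemma map_add (t : ℝ≥0) (φ ψ : C(Y, ℝ)) : S.Q t (φ + ψ) = S.Q t φ + S.Q t ψ := by
  ext y
  simp only [S.apply_eq, ContinuousMap.add_apply]
  exact integral_add (integrable φ _) (integrable ψ _)

lemma map_sub (t : ℝ≥0) (φ ψ : C(Y, ℝ)) : S.Q t (φ - ψ) = S.Q t φ - S.Q t ψ := by
  ext y
  simp only [S.apply_eq, ContinuousMap.sub_apply]
  exact integral_sub (integrable φ _) (integrable ψ _)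

lemma map_smul (t : ℝ≥0) (c : ℝ) (φ : C(Y, ℝ)) : S.Q t (c • φ) = c • S.Q t φ := by
  ext y
  simp only [S.apply_eq, ContinuousMap.smul_apply]
  exact integral_smul _ _

lemma map_const (t : ℝ≥0) (c : ℝ) : S.Q t (ContinuousMap.const Y c) = ContinuousMap.const Y c := by
  ext y
  simp [S.apply_eq]

lemma mono (t : ℝ≥0) {φ ψ : C(Y, ℝ)} (h : φ ≤ ψ) : S.Q t φ ≤ S.Q t ψ := by
  refine ContinuousMap.le_def.2 fun y => ?_
  rw [S.apply_eq, S.apply_eq]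
  exact integral_mono (integrable φ _) (integrable ψ _) (ContinuousMap.le_def.1 h)

lemma nonneg (t : ℝ≥0) {φ : C(Y, ℝ)} (h : 0 ≤ φ) : 0 ≤ S.Q t φ := by
  refine ContinuousMap.le_def.2 fun y => ?_
  rw [S.apply_eq]
  exact integral_nonneg (ContinuousMap.le_def.1 h)

lemma norm_le (t : ℝ≥0) (φ : C(Y, ℝ)) : ‖S.Q t φ‖ ≤ ‖φ‖ := by
  refine (ContinuousMap.norm_le _ (norm_nonneg _)).2 fun y => ?_
  rw [S.apply_eq]
  simpa using norm_integral_le_of_norm_le_const (μ := S.κ t y)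
    (Eventually.of_forall φ.norm_coe_le_norm)

lemma norm_sub_le (t : ℝ≥0) (φ ψ : C(Y, ℝ)) : ‖S.Q t φ - S.Q t ψ‖ ≤ ‖φ - ψ‖ := by
  rw [← S.map_sub]; exact S.norm_le _ _

/-! #### Excessive functions -/

/-- A nonnegative function `u` is `c`-excessive if `e^{-ct} Q_t u ≤ u` for all `t`. -/
def Excessive (c : ℝ) (u : C(Y, ℝ)) : Prop :=
  0 ≤ u ∧ ∀ t : ℝ≥0, Real.exp (-(c * t)) • S.Q t u ≤ u

variable {S}

lemma Excessive.weaken {c d : ℝ} {u : C(Y, ℝ)} (hu : S.Excessive c u) (h : c ≤ d) :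
    S.Excessive d u := by
  refine ⟨hu.1, fun t => ContinuousMap.le_def.2 fun y =>
    le_trans ?_ (ContinuousMap.le_def.1 (hu.2 t) y)⟩
  have : 0 ≤ S.Q t u y := ContinuousMap.le_def.1 (S.nonneg t hu.1) y
  simp only [ContinuousMap.smul_apply, smul_eq_mul]
  gcongr

lemma Excessive.add {c : ℝ} {u v : C(Y, ℝ)} (hu : S.Excessive c u) (hv : S.Excessive c v) :
    S.Excessive c (u + v) := by
  refine ⟨add_nonneg hu.1 hv.1, fun t => ?_⟩
  rw [S.map_add, smul_add]
  exact add_le_add (hu.2 t) (hv.2 t)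

lemma Excessive.smul {c : ℝ} {u : C(Y, ℝ)} (hu : S.Excessive c u) {a : ℝ} (ha : 0 ≤ a) :
    S.Excessive c (a • u) := by
  refine ⟨smul_nonneg ha hu.1, fun t => ?_⟩
  rw [S.map_smul, smul_comm]
  exact smul_le_smul_of_nonneg_left (hu.2 t) ha

/-- Positivity of Q_t gives Q_t(u ⊓ v) ≤ Q_t u ⊓ Q_t v. This is what makes `excessiveDiff` a
lattice. -/
lemma Excessive.inf {c : ℝ} {u v : C(Y, ℝ)} (hu : S.Excessive c u) (hv : S.Excessive c v) :
    S.Excessive c (u ⊓ v) := by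
  refine ⟨le_inf hu.1 hv.1, fun t => le_inf ?_ ?_⟩
  · exact (smul_le_smul_of_nonneg_left (S.mono t inf_le_left) (Real.exp_nonneg _)).trans (hu.2 t)
  · exact (smul_le_smul_of_nonneg_left (S.mono t inf_le_right) (Real.exp_nonneg _)).trans (hv.2 t)

lemma excessive_const {c a : ℝ} (hc : 0 ≤ c) (ha : 0 ≤ a) :
    S.Excessive c (ContinuousMap.const Y a) := by
  refine ⟨ContinuousMap.le_def.2 fun _ => ha, fun t => ContinuousMap.le_def.2 fun y => ?_⟩
  rw [S.map_const]
  simp only [ContinuousMap.smul_apply, smul_eq_mul, ContinuousMap.const_apply]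
  have : Real.exp (-(c * t)) ≤ 1 :=
    Real.exp_le_one_iff.2 (neg_nonpos.2 (mul_nonneg hc t.coe_nonneg))
  nlinarith

lemma Excessive.antitone {c : ℝ} {u : C(Y, ℝ)} (hu : S.Excessive c u) :
    Antitone fun t : ℝ≥0 => Real.exp (-(c * t)) • S.Q t u := by
  intro s t hst
  obtain ⟨r, rfl⟩ := exists_add_of_le hst
  have h1 : Real.exp (-(c * (s + r : ℝ≥0))) • S.Q (s + r) u
      = Real.exp (-(c * s)) • S.Q s (Real.exp (-(c * r)) • S.Q r u) := by
    rw [S.add, S.map_smul, smul_smul, ← Real.exp_add]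
    congr 2
    push_cast; ring
  simp only [h1]
  exact smul_le_smul_of_nonneg_left (S.mono s (hu.2 r)) (Real.exp_nonneg _)

/-- The discounted orbit increases to u as t decreases to 0, pointwise by right-continuity, so
Dini's theorem on the compact space upgrades the convergence to uniform. -/
lemma Excessive.tendsto {c : ℝ} {u : C(Y, ℝ)} (hu : S.Excessive c u) :
    Tendsto (fun t => S.Q t u) (𝓝 0) (𝓝 u) := by
  let a : ℝ≥0 → C(Y, ℝ) := fun t => Real.exp (-(c * t)) • S.Q t u
  have ha : Antitone a := hu.antitone
  have hexp : Tendsto (fun t : ℝ≥0 => Real.exp (-(c * t))) (𝓝 0) (𝓝 1) := by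
    have : Continuous fun t : ℝ≥0 => Real.exp (-(c * t)) := by fun_prop
    simpa using this.tendsto 0
  have hpt : ∀ y, Tendsto (fun t => a t y) (𝓝 0) (𝓝 (u y)) := fun y => by
    have h1 : Tendsto (fun s => S.Q s u y) (𝓝 0) (𝓝 (u y)) := by
      have := (S.rightCont u y 0).tendsto
      rwa [S.zero, show Ici (0 : ℝ≥0) = univ from by ext; simp, nhdsWithin_univ] at this
    simpa [a] using hexp.mul h1
  let h : ℕ → ℝ≥0 := fun n => 1 / ((n : ℝ≥0) + 1)
  have hh : Antitone h := fun m n hmn => by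
    simp only [h]; gcongr
  have hdini : Tendsto (fun n => a (h n)) atTop (𝓝 u) :=
    ContinuousMap.tendsto_of_monotone_of_pointwise (fun m n hmn => ha (hh hmn))
      fun y => (hpt y).comp tendsto_one_div_succ_nnreal
  have hle : ∀ t, a t ≤ u := hu.2
  -- Dini covers only a sequence of times; for t ≤ h n the sandwich a (h n) ≤ a t ≤ u extends it to
  -- all small t.
  have hat : Tendsto a (𝓝 0) (𝓝 u) := by
    rw [Metric.tendsto_nhds]
    intro ε hε
    obtain ⟨n, hn⟩ := ((Metric.tendsto_nhds.1 hdini) ε hε).exists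
    filter_upwards [Iic_mem_nhds (show 0 < h n by positivity)] with t ht
    refine lt_of_le_of_lt ?_ hn
    rw [ContinuousMap.dist_le dist_nonneg]
    intro y
    have h1 := ContinuousMap.le_def.1 (ha ht) y
    have h2 := ContinuousMap.le_def.1 (hle t) y
    have h3 := ContinuousMap.dist_apply_le_dist (f := a (h n)) (g := u) y
    rw [Real.dist_eq] at h3 ⊢
    rw [abs_sub_comm, abs_of_nonneg (by linarith)]
    rw [abs_sub_comm, abs_of_nonneg (by linarith)] at h3
    linarith
  -- Multiplying by e^{ct} removes the discount.
  have hexp' : Tendsto (fun t : ℝ≥0 => Real.exp (c * t)) (𝓝 0) (𝓝 1) := by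
    have : Continuous fun t : ℝ≥0 => Real.exp (c * t) := by fun_prop
    simpa using this.tendsto 0
  have := hexp'.smul hat
  simp only [a, smul_smul, ← Real.exp_add] at this
  simpa using this

/-! #### Resolvents -/

variable (S)

lemma measurable_uncurry (φ : C(Y, ℝ)) : Measurable (Function.uncurry fun s y => S.Q s φ y) :=
  measurable_uncurry_of_rightContinuous (fun s => (S.Q s φ).continuous.measurable)
    fun y t => S.rightCont φ y t

lemma measurable_resolvent_integrand (r : ℝ≥0) (φ : C(Y, ℝ)) :
    Measurable fun p : ℝ × Y => Real.exp (-p.1) * S.Q (p.1.toNNReal * r) φ p.2 := by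
  have h := (S.measurable_uncurry φ).comp (f := fun p : ℝ × Y => (p.1.toNNReal * r, p.2))
    (((measurable_real_toNNReal.comp measurable_fst).mul_const r).prodMk measurable_snd)
  exact (Real.measurable_exp.comp measurable_fst.neg).mul h

lemma norm_resolvent_integrand_le (r : ℝ≥0) (φ : C(Y, ℝ)) (s : ℝ) (y : Y) :
    ‖Real.exp (-s) * S.Q (s.toNNReal * r) φ y‖ ≤ Real.exp (-s) * ‖φ‖ := by
  rw [norm_mul, Real.norm_eq_abs, abs_of_pos (Real.exp_pos _)]
  gcongr
  exact ((S.Q _ φ).norm_coe_le_norm y).trans (S.norm_le _ φ)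

lemma integrableOn_exp_neg_mul (C : ℝ) : IntegrableOn (fun s : ℝ => Real.exp (-s) * C) (Ioi 0) :=
  (integrableOn_exp_neg_Ioi 0).mul_const C

lemma integrable_resolvent_integrand (r : ℝ≥0) (φ : C(Y, ℝ)) (y : Y) :
    IntegrableOn (fun s : ℝ => Real.exp (-s) * S.Q (s.toNNReal * r) φ y) (Ioi 0) :=
  (integrableOn_exp_neg_mul ‖φ‖).mono'
    ((S.measurable_resolvent_integrand r φ).comp measurable_prodMk_right).aestronglyMeasurable
    (Eventually.of_forall fun s => S.norm_resolvent_integrand_le r φ s y)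

/-- The resolvent `∫_0^∞ e^{-s} Q_{rs} φ ds`. -/
def resolvent [FirstCountableTopology Y] (r : ℝ≥0) (φ : C(Y, ℝ)) : C(Y, ℝ) where
  toFun y := ∫ s in Ioi (0 : ℝ), Real.exp (-s) * S.Q (s.toNNReal * r) φ y
  continuous_toFun := by
    refine continuous_of_dominated (bound := fun s => Real.exp (-s) * ‖φ‖) (fun y => ?_)
      (fun y => Eventually.of_forall fun s => S.norm_resolvent_integrand_le r φ s y)
      (integrableOn_exp_neg_mul ‖φ‖)
      (Eventually.of_forall fun s => by fun_prop)
    exact (S.integrable_resolvent_integrand r φ y).aestronglyMeasurable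

lemma resolvent_apply [FirstCountableTopology Y] (r : ℝ≥0) (φ : C(Y, ℝ)) (y : Y) :
    S.resolvent r φ y = ∫ s in Ioi (0 : ℝ), Real.exp (-s) * S.Q (s.toNNReal * r) φ y := rfl

/-- With this scaling, r⁻¹ times the usual resolvent at rate 1/r, the integrand is dominated by
e^{-s}‖φ‖ uniformly in r. Pointwise convergence is enough, since it serves only to separate points.
-/
lemma tendsto_resolvent [FirstCountableTopology Y] (φ : C(Y, ℝ)) (y : Y) {r : ℕ → ℝ≥0}
    (hr : Tendsto r atTop (𝓝 0)) :
    Tendsto (fun n => S.resolvent (r n) φ y) atTop (𝓝 (φ y)) := by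
  have h1 : φ y = ∫ s in Ioi (0 : ℝ), Real.exp (-s) * φ y := by
    rw [integral_mul_const, integral_exp_neg_Ioi]; simp
  rw [h1]
  simp only [resolvent_apply]
  refine tendsto_integral_of_dominated_convergence (fun s => Real.exp (-s) * ‖φ‖)
    (fun n => (S.integrable_resolvent_integrand _ φ y).aestronglyMeasurable)
    (integrableOn_exp_neg_mul ‖φ‖)
    (fun n => Eventually.of_forall fun s => S.norm_resolvent_integrand_le _ φ s y)
    (Eventually.of_forall fun s => Tendsto.const_mul _ ?_)
  have := (S.rightCont φ y 0).tendsto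
  rw [S.zero, show Ici (0 : ℝ≥0) = univ from by ext; simp, nhdsWithin_univ] at this
  exact this.comp (by simpa using hr.const_mul (s).toNNReal)

lemma Q_resolvent_apply [FirstCountableTopology Y] (r t : ℝ≥0) (φ : C(Y, ℝ)) (y : Y) :
    S.Q t (S.resolvent r φ) y =
      ∫ s in Ioi (0 : ℝ), Real.exp (-s) * S.Q (t + s.toNNReal * r) φ y := by
  rw [S.apply_eq]
  simp only [resolvent_apply]
  rw [integral_integral_swap]
  · refine integral_congr_ae (Eventually.of_forall fun s => ?_)
    simp only
    rw [integral_const_mul, ← S.apply_eq, ← S.add]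
  · have hb : Integrable (fun p : Y × ℝ => Real.exp (-p.2) * ‖φ‖)
        ((S.κ t y).prod (volume.restrict (Ioi 0))) :=
      (integrableOn_exp_neg_mul ‖φ‖).integrable.comp_snd _
    exact hb.mono' ((S.measurable_resolvent_integrand r φ).comp measurable_swap).aestronglyMeasurable
      (Eventually.of_forall fun p => S.norm_resolvent_integrand_le r φ p.2 p.1)

/-- Applying the discounted Q_t shifts the integration variable by a = t/r, so the integral from 0
becomes the integral from a of the same nonnegative function. -/
lemma excessive_resolvent [FirstCountableTopology Y] {r : ℝ≥0} (hr : r ≠ 0) {φ : C(Y, ℝ)}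
    (hφ : 0 ≤ φ) : S.Excessive (1 / r) (S.resolvent r φ) := by
  have hpos : ∀ (s : ℝ) (y : Y), 0 ≤ Real.exp (-s) * S.Q (s.toNNReal * r) φ y := fun s y =>
    mul_nonneg (Real.exp_nonneg _) (ContinuousMap.le_def.1 (S.nonneg _ hφ) y)
  refine ⟨ContinuousMap.le_def.2 fun y => ?_, fun t => ContinuousMap.le_def.2 fun y => ?_⟩
  · exact integral_nonneg fun s => hpos s y
  · have hr' : (r : ℝ) ≠ 0 := by exact_mod_cast hr
    set a : ℝ := 1 / r * t with ha
    have ha0 : 0 ≤ a := by positivity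
    have h1 : Real.exp (-a) * S.Q t (S.resolvent r φ) y
        = ∫ s in Ioi (0 : ℝ), Real.exp (-(s + a)) * S.Q ((s + a).toNNReal * r) φ y := by
      rw [Q_resolvent_apply, ← integral_const_mul]
      refine setIntegral_congr_fun measurableSet_Ioi fun s hs => ?_
      have hs' : (0 : ℝ) ≤ s := le_of_lt hs
      have h2 : (s + a).toNNReal * r = t + s.toNNReal * r := by
        rw [Real.toNNReal_add hs' ha0, add_mul, add_comm]
        congr 1
        ext
        rw [NNReal.coe_mul, Real.coe_toNNReal _ ha0, ha]
        field_simp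
      rw [h2, neg_add, Real.exp_add]; ring
    have h3 : ∫ s in Ioi (0 : ℝ), Real.exp (-(s + a)) * S.Q ((s + a).toNNReal * r) φ y
        = ∫ s in Ioi a, Real.exp (-s) * S.Q (s.toNNReal * r) φ y := by
      have := (measurePreserving_add_right (volume : Measure ℝ) a).setIntegral_preimage_emb
        (measurableEmbedding_addRight a) (fun s => Real.exp (-s) * S.Q (s.toNNReal * r) φ y) (Ioi a)
      rw [← this]
      congr 2
      ext s; simp
    simp only [ContinuousMap.smul_apply, smul_eq_mul]
    rw [h1, h3]
    exact setIntegral_mono_set (S.integrable_resolvent_integrand r φ y)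
      (Eventually.of_forall fun s => hpos s y) (Ioi_subset_Ioi ha0).eventuallyLE

/-! #### Strong continuity -/

/-- Differences of excessive functions. -/
def excessiveDiff : Set C(Y, ℝ) :=
  {w | ∃ c u v, 0 ≤ c ∧ S.Excessive c u ∧ S.Excessive c v ∧ w = u - v}

variable {S}

lemma excessiveDiff_add {w z : C(Y, ℝ)} (hw : w ∈ S.excessiveDiff) (hz : z ∈ S.excessiveDiff) :
    w + z ∈ S.excessiveDiff := by
  obtain ⟨c, u, v, hc, hu, hv, rfl⟩ := hw
  obtain ⟨c', u', v', hc', hu', hv', rfl⟩ := hz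
  exact ⟨c + c', u + u', v + v', by positivity,
    (hu.weaken (by linarith)).add (hu'.weaken (by linarith)),
    (hv.weaken (by linarith)).add (hv'.weaken (by linarith)), by abel⟩

lemma excessiveDiff_neg {w : C(Y, ℝ)} (hw : w ∈ S.excessiveDiff) : -w ∈ S.excessiveDiff := by
  obtain ⟨c, u, v, hc, hu, hv, rfl⟩ := hw
  exact ⟨c, v, u, hc, hv, hu, by abel⟩

lemma excessiveDiff_smul {w : C(Y, ℝ)} (hw : w ∈ S.excessiveDiff) (a : ℝ) :
    a • w ∈ S.excessiveDiff := by
  have key : ∀ b : ℝ, 0 ≤ b → b • w ∈ S.excessiveDiff := fun b hb => by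
    obtain ⟨c, u, v, hc, hu, hv, rfl⟩ := hw
    exact ⟨c, b • u, b • v, hc, hu.smul hb, hv.smul hb, by rw [smul_sub]⟩
  rcases le_total 0 a with ha | ha
  · exact key a ha
  · simpa using excessiveDiff_neg (key (-a) (by linarith))

lemma excessiveDiff_const (a : ℝ) : ContinuousMap.const Y a ∈ S.excessiveDiff := by
  have h1 : ContinuousMap.const Y (1 : ℝ) ∈ S.excessiveDiff :=
    ⟨0, ContinuousMap.const Y 1, ContinuousMap.const Y 0, le_rfl,
      excessive_const le_rfl zero_le_one, excessive_const le_rfl le_rfl, by ext; simp⟩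
  have h2 := excessiveDiff_smul h1 a
  convert h2 using 1
  ext; simp

/-- (u - v) ⊓ (u' - v') = (u + v') ⊓ (u' + v) - (v + v'), after passing to the common rate c + c'.
-/
lemma excessiveDiff_inf {w z : C(Y, ℝ)} (hw : w ∈ S.excessiveDiff) (hz : z ∈ S.excessiveDiff) :
    w ⊓ z ∈ S.excessiveDiff := by
  obtain ⟨c, u, v, hc, hu, hv, rfl⟩ := hw
  obtain ⟨c', u', v', hc', hu', hv', rfl⟩ := hz
  have hu := hu.weaken (show c ≤ c + c' by linarith)
  have hv := hv.weaken (show c ≤ c + c' by linarith)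
  have hu' := hu'.weaken (show c' ≤ c + c' by linarith)
  have hv' := hv'.weaken (show c' ≤ c + c' by linarith)
  refine ⟨c + c', (u + v') ⊓ (u' + v), v + v', by positivity, (hu.add hv').inf (hu'.add hv),
    hv.add hv', ?_⟩
  ext y
  simp only [ContinuousMap.inf_apply, ContinuousMap.sub_apply, ContinuousMap.add_apply]
  rw [← min_sub_sub_right]
  congr 1 <;> ring

lemma excessiveDiff_sup {w z : C(Y, ℝ)} (hw : w ∈ S.excessiveDiff) (hz : z ∈ S.excessiveDiff) :
    w ⊔ z ∈ S.excessiveDiff := by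
  have := excessiveDiff_neg (excessiveDiff_inf (excessiveDiff_neg hw) (excessiveDiff_neg hz))
  convert this using 1
  ext y
  simp [max_def, min_def]
  split_ifs <;> linarith

/-- A Urysohn function separates the points, and its resolvent, which is excessive, is close to it
at both points for small r. -/
lemma excessiveDiff_separates [T2Space Y] [FirstCountableTopology Y] {x y : Y} (hxy : x ≠ y) :
    ∃ w ∈ S.excessiveDiff, w x ≠ w y := by
  obtain ⟨φ, hφx, hφy, hφ⟩ := exists_continuous_zero_one_of_isClosed (X := Y)
    (isClosed_singleton (x := x)) (isClosed_singleton (x := y)) (by simpa using hxy)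
  have hφx : φ x = 0 := hφx rfl
  have hφy : φ y = 1 := hφy rfl
  have hφ0 : 0 ≤ φ := ContinuousMap.le_def.2 fun z => (hφ z).1
  have hx := S.tendsto_resolvent φ x tendsto_one_div_succ_nnreal
  have hy := S.tendsto_resolvent φ y tendsto_one_div_succ_nnreal
  rw [hφx] at hx
  rw [hφy] at hy
  obtain ⟨n, h1, h2⟩ := ((hx.eventually (gt_mem_nhds (show (0 : ℝ) < 1 / 2 by norm_num))).and
    (hy.eventually (lt_mem_nhds (show (1 / 2 : ℝ) < 1 by norm_num)))).exists
  have hn : (1 : ℝ≥0) / ((n : ℝ≥0) + 1) ≠ 0 := by positivity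
  refine ⟨S.resolvent (1 / ((n : ℝ≥0) + 1)) φ, ⟨_, _, ContinuousMap.const Y 0, ?_,
    S.excessive_resolvent hn hφ0, excessive_const ?_ le_rfl, ?_⟩, ?_⟩
  · positivity
  · positivity
  · ext; simp
  · exact (h1.trans h2).ne

lemma dense_excessiveDiff [T2Space Y] [FirstCountableTopology Y] :
    closure S.excessiveDiff = univ := by
  refine ContinuousMap.sublattice_closure_eq_top _ ⟨_, excessiveDiff_const 0⟩
    (fun w hw z hz => excessiveDiff_inf hw hz) (fun w hw z hz => excessiveDiff_sup hw hz) ?_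
  intro v x y
  by_cases hxy : x = y
  · subst hxy
    exact ⟨_, excessiveDiff_const (v x), rfl, rfl⟩
  · obtain ⟨w, hw, hne⟩ := excessiveDiff_separates (S := S) hxy
    have hne' : w y - w x ≠ 0 := sub_ne_zero.2 hne.symm
    -- The affine function of w taking the prescribed values v x and v y at the two points.
    refine ⟨ContinuousMap.const Y (v x) + ((v y - v x) / (w y - w x)) •
      (w + ContinuousMap.const Y (-w x)), excessiveDiff_add (excessiveDiff_const _)
        (excessiveDiff_smul (excessiveDiff_add hw (excessiveDiff_const _)) _), ?_, ?_⟩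
    · simp
    · simp only [ContinuousMap.add_apply, ContinuousMap.smul_apply, ContinuousMap.const_apply,
        smul_eq_mul]
      field_simp
      ring

variable (S)

lemma tendsto_zero [T2Space Y] [FirstCountableTopology Y] (φ : C(Y, ℝ)) :
    Tendsto (fun t => S.Q t φ) (𝓝 0) (𝓝 φ) := by
  rw [Metric.tendsto_nhds]
  intro ε hε
  have hmem : φ ∈ closure S.excessiveDiff := by rw [dense_excessiveDiff]; trivial
  obtain ⟨w, ⟨c, u, v, -, hu, hv, rfl⟩, hw⟩ := Metric.mem_closure_iff.1 hmem (ε / 3) (by positivity)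
  have h1 := hu.tendsto.sub hv.tendsto
  filter_upwards [Metric.tendsto_nhds.1 h1 (ε / 3) (by positivity)] with t ht
  have h2 : dist (S.Q t φ) (S.Q t (u - v)) ≤ dist φ (u - v) := by
    simpa only [dist_eq_norm] using S.norm_sub_le t φ (u - v)
  rw [← S.map_sub] at ht
  have h3 := dist_triangle4 (S.Q t φ) (S.Q t (u - v)) (u - v) φ
  rw [dist_comm (u - v) φ] at h3
  linarith

/-- A pointwise right-continuous Feller semigroup is strongly continuous. -/
theorem strongly_continuous [T2Space Y] [FirstCountableTopology Y] :
    Continuous fun p : ℝ≥0 × C(Y, ℝ) => S.Q p.1 p.2 := by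
  rw [Metric.continuous_iff]
  rintro ⟨t, φ⟩ ε hε
  obtain ⟨δ, hδ, hd⟩ := Metric.tendsto_nhds_nhds.1 (S.tendsto_zero φ) (ε / 2) (by positivity)
  refine ⟨min δ (ε / 2), by positivity, ?_⟩
  rintro ⟨s, ψ⟩ hs
  rw [Prod.dist_eq, max_lt_iff] at hs
  have h1 : dist (S.Q s ψ) (S.Q s φ) < ε / 2 := by
    refine lt_of_le_of_lt ?_ (hs.2.trans_le (min_le_right _ _))
    simpa only [dist_eq_norm] using S.norm_sub_le s ψ φ
  -- Q_b φ - Q_a φ = Q_a (Q_{b-a} φ - φ) and Q_a is a contraction, so continuity at 0 also gives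
  -- left continuity.
  have key : ∀ a b : ℝ≥0, a ≤ b → dist a b < δ → dist (S.Q b φ) (S.Q a φ) < ε / 2 := by
    intro a b hab hlt
    obtain ⟨r, rfl⟩ := exists_add_of_le hab
    rw [S.add]
    refine lt_of_le_of_lt ?_ (hd (x := r) ?_)
    · simpa only [dist_eq_norm] using S.norm_sub_le a (S.Q r φ) φ
    · simpa [NNReal.dist_eq] using hlt
  have h2 : dist (S.Q s φ) (S.Q t φ) < ε / 2 := by
    have hst := hs.1.trans_le (min_le_left _ _)
    rcases le_total s t with h | h
    · rw [dist_comm]; exact key s t h hst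
    · exact key t s h (by rwa [dist_comm])
  linarith [dist_triangle (S.Q s ψ) (S.Q s φ) (S.Q t φ)]

end FellerSemigroup

/-! ### Measurability and integrability of the rewards -/

/-- Turns estimates uniform over stopping times into estimates between value functions. Nonemptiness
and boundedness rule out the default value of the real `sSup`. -/
lemma abs_sSup_image_sub_le {α : Type*} {S : Set α} {a b : α → ℝ} {ε : ℝ} (hS : S.Nonempty)
    (ha : BddAbove (a '' S)) (h : ∀ i ∈ S, |a i - b i| ≤ ε) :
    |sSup (a '' S) - sSup (b '' S)| ≤ ε := by
  have hb : BddAbove (b '' S) := by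
    obtain ⟨B, hB⟩ := ha
    refine ⟨B + ε, ?_⟩
    rintro _ ⟨i, hi, rfl⟩
    have := hB ⟨i, hi, rfl⟩
    have := abs_le.1 (h i hi)
    linarith
  have key : ∀ {a b : α → ℝ}, BddAbove (b '' S) → (∀ i ∈ S, |a i - b i| ≤ ε) →
      sSup (a '' S) ≤ sSup (b '' S) + ε := fun {a b} hb h => by
    refine csSup_le (hS.image a) ?_
    rintro _ ⟨i, hi, rfl⟩
    have h1 := le_csSup hb ⟨i, hi, rfl⟩
    have := abs_le.1 (h i hi)
    linarith
  rw [abs_sub_le_iff]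
  constructor
  · linarith [key hb h]
  · linarith [key ha fun i hi => (abs_sub_comm (b i) (a i)).trans_le (h i hi)]

namespace MarkovProcess

variable {E Ω : Type*} [MetricSpace E] [MeasurableSpace E] [BorelSpace E]
  [mΩ : MeasurableSpace Ω] (M : MarkovProcess E Ω)

instance (x : E) : IsProbabilityMeasure (M.P x) := M.isProbabilityMeasure x

lemma measurable_X (t : ℝ≥0) : Measurable (M.X t) :=
  (M.adapted t).mono (M.filtration.le t) le_rfl

lemma rightCont_comp {φ : E → ℝ} (hφ : Continuous φ) (ω : Ω) (t : ℝ≥0) :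
    ContinuousWithinAt (fun s => φ (M.X s ω)) (Ici t) t :=
  hφ.continuousAt.comp_continuousWithinAt (M.rightContinuous ω t)

lemma measurable_uncurry {φ : E → ℝ} (hφ : Continuous φ) :
    Measurable (Function.uncurry fun s ω => φ (M.X s ω)) :=
  measurable_uncurry_of_rightContinuous (fun s => hφ.measurable.comp (M.measurable_X s))
    fun ω t => M.rightCont_comp hφ ω t

variable {M}

lemma measurableSet_le_of_mem {t : ℝ≥0} {τ : Ω → ℝ≥0} (hτ : τ ∈ M.stoppingTimes t) (i : ℝ≥0) :
    MeasurableSet[M.filtration i] {ω | τ ω ≤ i} := by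
  have := hτ.1 i
  simpa only [WithTop.coe_le_coe] using this

lemma mem_stoppingTimes {t : ℝ≥0} {τ : Ω → ℝ≥0}
    (h : ∀ i, MeasurableSet[M.filtration i] {ω | τ ω ≤ i}) (ht : ∀ ω, τ ω ≤ t) :
    τ ∈ M.stoppingTimes t :=
  ⟨fun i => by simpa only [WithTop.coe_le_coe] using h i, ht⟩

lemma stoppingTimes_mono {s t : ℝ≥0} (h : s ≤ t) : M.stoppingTimes s ⊆ M.stoppingTimes t :=
  fun _ hτ => ⟨hτ.1, fun ω => (hτ.2 ω).trans h⟩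

lemma const_mem_stoppingTimes {s t : ℝ≥0} (h : s ≤ t) :
    (fun _ => s) ∈ M.stoppingTimes t :=
  mem_stoppingTimes (fun _ => MeasurableSet.const _) fun _ => h

lemma stoppingTimes_nonempty (t : ℝ≥0) : (M.stoppingTimes t).Nonempty :=
  ⟨_, const_mem_stoppingTimes (le_refl t)⟩

lemma measurable_of_mem_stoppingTimes {t : ℝ≥0} {τ : Ω → ℝ≥0} (hτ : τ ∈ M.stoppingTimes t) :
    Measurable τ :=
  measurable_of_Iic fun i => M.filtration.le i _ (measurableSet_le_of_mem hτ i)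

lemma measurable_terminal {φ : E → ℝ} (hφ : Continuous φ) {τ : Ω → ℝ≥0} (hτ : Measurable τ) :
    Measurable fun ω => φ (M.X (τ ω) ω) :=
  (M.measurable_uncurry hφ).comp (hτ.prodMk measurable_id)

lemma measurable_running {φ : E → ℝ} (hφ : Continuous φ) :
    Measurable fun p : ℝ × Ω => φ (M.X p.1.toNNReal p.2) :=
  (M.measurable_uncurry hφ).comp (f := fun p : ℝ × Ω => (p.1.toNNReal, p.2))
    ((measurable_real_toNNReal.comp measurable_fst).prodMk measurable_snd)

lemma intervalIntegrable_running {f : E → ℝ} {C : ℝ} (hf : Continuous f) (hC : ∀ x, |f x| ≤ C)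
    (ω : Ω) (a b : ℝ) : IntervalIntegrable (fun s => f (M.X s.toNNReal ω)) volume a b :=
  (intervalIntegrable_const (c := C)).mono_fun'
    ((M.measurable_running hf).comp measurable_prodMk_right).aestronglyMeasurable
    (Eventually.of_forall fun _ => hC _)

lemma measurable_integral_running {f : E → ℝ} (hf : Continuous f) {σ τ : Ω → ℝ≥0}
    (hσ : Measurable σ) (hτ : Measurable τ) :
    Measurable fun ω => ∫ s in (σ ω : ℝ)..(τ ω : ℝ), f (M.X s.toNNReal ω) := by
  have key : ∀ {σ τ : Ω → ℝ≥0}, Measurable σ → Measurable τ →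
      Measurable fun ω => ∫ s in Ioc (σ ω : ℝ) (τ ω), f (M.X s.toNNReal ω) := by
    intro σ τ hσ hτ
    have hS : MeasurableSet {p : Ω × ℝ | p.2 ∈ Ioc (σ p.1 : ℝ) (τ p.1)} :=
      (measurableSet_lt (hσ.coe_nnreal_real.comp measurable_fst) measurable_snd).inter
        (measurableSet_le measurable_snd (hτ.coe_nnreal_real.comp measurable_fst))
    have h1 : Measurable (indicator {p : Ω × ℝ | p.2 ∈ Ioc (σ p.1 : ℝ) (τ p.1)}
        fun p => f (M.X p.2.toNNReal p.1)) :=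
      ((M.measurable_running hf).comp measurable_swap).indicator hS
    have h2 := (h1.stronglyMeasurable.integral_prod_right' (ν := (volume : Measure ℝ))).measurable
    convert h2 using 2 with ω
    rw [← integral_indicator measurableSet_Ioc]
    rfl
  exact (key hσ hτ).sub (key hτ hσ)

lemma abs_integral_running_le {f : E → ℝ} {C : ℝ} (hC : ∀ x, |f x| ≤ C) (ω : Ω) (a b : ℝ) :
    |∫ s in a..b, f (M.X s.toNNReal ω)| ≤ C * |b - a| := by
  rw [← Real.norm_eq_abs]
  exact intervalIntegral.norm_integral_le_of_norm_le_const fun _ _ => hC _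

lemma integrable_integral_running {f : E → ℝ} {C : ℝ} (hf : Continuous f) (hC : ∀ x, |f x| ≤ C)
    {t : ℝ≥0} {σ τ : Ω → ℝ≥0} (hσ : Measurable σ) (hτ : Measurable τ) (hσt : ∀ ω, σ ω ≤ t)
    (hτt : ∀ ω, τ ω ≤ t) (x : E) :
    Integrable (fun ω => ∫ s in (σ ω : ℝ)..(τ ω : ℝ), f (M.X s.toNNReal ω)) (M.P x) := by
  refine Integrable.of_bound (measurable_integral_running hf hσ hτ).aestronglyMeasurable (C * t)
    (Eventually.of_forall fun ω => (abs_integral_running_le hC ω _ _).trans ?_)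
  have h0 : 0 ≤ C := (abs_nonneg _).trans (hC (M.X 0 ω))
  have h1 : (τ ω : ℝ) ≤ t := hτt ω
  have h2 : (σ ω : ℝ) ≤ t := hσt ω
  gcongr
  rw [abs_le]
  constructor <;> linarith [(τ ω).coe_nonneg, (σ ω).coe_nonneg]

lemma integrable_terminal_of_bound {g : E → ℝ} {C : ℝ} (hg : Continuous g) (hC : ∀ x, |g x| ≤ C)
    {τ : Ω → ℝ≥0} (hτ : Measurable τ) (x : E) :
    Integrable (fun ω => g (M.X (τ ω) ω)) (M.P x) :=
  Integrable.of_bound (measurable_terminal hg hτ).aestronglyMeasurable C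
    (Eventually.of_forall fun _ => hC _)

lemma integrable_running {f : E → ℝ} {C : ℝ} (hf : Continuous f) (hC : ∀ x, |f x| ≤ C)
    {t : ℝ≥0} {τ : Ω → ℝ≥0} (hτ : τ ∈ M.stoppingTimes t) (x : E) :
    Integrable (fun ω => ∫ s in (0 : ℝ)..(τ ω : ℝ), f (M.X s.toNNReal ω)) (M.P x) := by
  simpa using integrable_integral_running (σ := fun _ => 0) hf hC measurable_const
    (measurable_of_mem_stoppingTimes hτ) (fun _ => zero_le) hτ.2 x

lemma integrable_reward {f g : E → ℝ} {C : ℝ} (hf : Continuous f) (hC : ∀ x, |f x| ≤ C)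
    {t : ℝ≥0} {τ : Ω → ℝ≥0} (hτ : τ ∈ M.stoppingTimes t) {x : E}
    (hg : Integrable (fun ω => g (M.X (τ ω) ω)) (M.P x)) :
    Integrable (M.reward f g τ) (M.P x) :=
  (integrable_running hf hC hτ x).add hg

lemma integral_reward {f g : E → ℝ} {C : ℝ} (hf : Continuous f) (hC : ∀ x, |f x| ≤ C)
    {t : ℝ≥0} {τ : Ω → ℝ≥0} (hτ : τ ∈ M.stoppingTimes t) {x : E}
    (hg : Integrable (fun ω => g (M.X (τ ω) ω)) (M.P x)) :
    ∫ ω, M.reward f g τ ω ∂M.P x =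
      (∫ ω, (∫ s in (0 : ℝ)..(τ ω : ℝ), f (M.X s.toNNReal ω)) ∂M.P x)
        + ∫ ω, g (M.X (τ ω) ω) ∂M.P x :=
  integral_add (integrable_running hf hC hτ x) hg

lemma integral_running_le {f : E → ℝ} {C : ℝ} (hf : Continuous f) (hC : ∀ x, |f x| ≤ C)
    {t : ℝ≥0} {τ : Ω → ℝ≥0} (hτ : τ ∈ M.stoppingTimes t) (x : E) :
    ∫ ω, (∫ s in (0 : ℝ)..(τ ω : ℝ), f (M.X s.toNNReal ω)) ∂M.P x ≤ C * t := by
  have h0 : 0 ≤ C := (abs_nonneg _).trans (hC x)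
  calc _ ≤ ∫ _, C * (t : ℝ) ∂M.P x := by
        refine integral_mono (integrable_running hf hC hτ x) (integrable_const _) fun ω => ?_
        refine (le_abs_self _).trans ((abs_integral_running_le hC ω _ _).trans ?_)
        have : (τ ω : ℝ) ≤ t := hτ.2 ω
        simp only [sub_zero, NNReal.abs_eq]
        gcongr
    _ = C * t := by simp

lemma bddAbove_expectedRewards {f g : E → ℝ} {C A : ℝ} (hf : Continuous f) (hC : ∀ x, |f x| ≤ C)
    {t : ℝ≥0} {x : E}
    (hg : ∀ τ ∈ M.stoppingTimes t, Integrable (fun ω => g (M.X (τ ω) ω)) (M.P x))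
    (hA : ∀ τ ∈ M.stoppingTimes t, ∫ ω, g (M.X (τ ω) ω) ∂M.P x ≤ A) :
    BddAbove (M.expectedRewards f g t x) := by
  refine ⟨C * t + A, ?_⟩
  rintro _ ⟨τ, hτ, rfl⟩
  simp only
  rw [integral_reward hf hC hτ (hg τ hτ)]
  exact add_le_add (integral_running_le hf hC hτ x) (hA τ hτ)

lemma bddAbove_expectedRewards_of_bound {f g : E → ℝ} {C D : ℝ} (hf : Continuous f)
    (hC : ∀ x, |f x| ≤ C) (hg : Continuous g) (hD : ∀ x, |g x| ≤ D) (t : ℝ≥0) (x : E) :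
    BddAbove (M.expectedRewards f g t x) := by
  refine bddAbove_expectedRewards (A := D) hf hC (fun τ hτ => integrable_terminal_of_bound hg hD
    (measurable_of_mem_stoppingTimes hτ) x) fun τ hτ => ?_
  calc _ ≤ ∫ _, D ∂M.P x := integral_mono (integrable_terminal_of_bound hg hD
          (measurable_of_mem_stoppingTimes hτ) x) (integrable_const _)
          fun ω => (le_abs_self _).trans (hD _)
    _ = D := by simp

/-! ### Truncation of the terminal reward -/

lemma continuous_truncation {g : E → ℝ} (hg : Continuous g) (n : ℕ) :
    Continuous fun y => min (max (g y) (-(n : ℝ))) (n : ℝ) := by fun_prop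

lemma abs_truncation_le (g : E → ℝ) (n : ℕ) (y : E) :
    |min (max (g y) (-(n : ℝ))) (n : ℝ)| ≤ n := by
  have : (0 : ℝ) ≤ n := n.cast_nonneg
  rw [abs_le]
  exact ⟨le_min (le_max_right _ _) (by linarith), min_le_right _ _⟩

lemma abs_sub_truncation_le (a : ℝ) (n : ℕ) :
    |a - min (max a (-(n : ℝ))) (n : ℝ)| ≤ if (n : ℝ) < |a| then |a| else 0 := by
  have hn : (0 : ℝ) ≤ n := n.cast_nonneg
  split_ifs with h
  · rcases le_total 0 a with ha | ha
    · rw [abs_of_nonneg ha] at h ⊢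
      rw [max_eq_left (by linarith), min_eq_right h.le, abs_of_nonneg (by linarith)]
      linarith
    · rw [abs_of_nonpos ha] at h ⊢
      rw [max_eq_right (by linarith), min_eq_left (by linarith), abs_of_nonpos (by linarith)]
      linarith
  · have := abs_le.1 (not_lt.1 h)
    rw [max_eq_left this.1, min_eq_left this.2]
    simp

lemma ofReal_abs_terminal_le {g : E → ℝ} {t T : ℝ≥0} (htT : t ≤ T) {τ : Ω → ℝ≥0}
    (hτ : τ ∈ M.stoppingTimes t) (ω : Ω) :
    ENNReal.ofReal |g (M.X (τ ω) ω)| ≤ M.runningSup g T ω :=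
  le_iSup₂_of_le (τ ω) ⟨zero_le, (hτ.2 ω).trans htT⟩ le_rfl

/-- Both the integrand and the domain grow when |g(X_τ)| is replaced by ζ_T; monotonicity of the
lower integral needs no measurability of ζ_T. -/
lemma lintegral_tail_le {g : E → ℝ} {t T : ℝ≥0} (htT : t ≤ T) {τ : Ω → ℝ≥0}
    (hτ : τ ∈ M.stoppingTimes t) (n : ℕ) (x : E) :
    ∫⁻ ω in {ω | (n : ℝ) < |g (M.X (τ ω) ω)|}, ENNReal.ofReal |g (M.X (τ ω) ω)| ∂M.P x ≤
      ∫⁻ ω in {ω | (n : ℝ≥0∞) < M.runningSup g T ω}, M.runningSup g T ω ∂M.P x := by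
  refine (lintegral_mono fun ω => ofReal_abs_terminal_le htT hτ ω).trans
    (lintegral_mono_set fun ω (hω : (n : ℝ) < _) => ?_)
  refine lt_of_lt_of_le ?_ (ofReal_abs_terminal_le htT hτ ω)
  rw [ENNReal.lt_ofReal_iff_toReal_lt (by simp)]
  simpa using hω

lemma lintegral_terminal_le {g : E → ℝ} (hg : Continuous g) {t T : ℝ≥0} (htT : t ≤ T)
    {τ : Ω → ℝ≥0} (hτ : τ ∈ M.stoppingTimes t) (n : ℕ) (x : E) :
    ∫⁻ ω, ENNReal.ofReal |g (M.X (τ ω) ω)| ∂M.P x ≤ n +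
      ∫⁻ ω in {ω | (n : ℝ≥0∞) < M.runningSup g T ω}, M.runningSup g T ω ∂M.P x := by
  have hm : Measurable fun ω => |g (M.X (τ ω) ω)| :=
    (measurable_terminal hg (measurable_of_mem_stoppingTimes hτ)).norm
  have hS : MeasurableSet {ω | (n : ℝ) < |g (M.X (τ ω) ω)|} :=
    measurableSet_lt measurable_const hm
  rw [← lintegral_add_compl _ hS, add_comm]
  refine add_le_add ?_ (lintegral_tail_le htT hτ n x)
  calc _ ≤ ∫⁻ _ in {ω | (n : ℝ) < |g (M.X (τ ω) ω)|}ᶜ, (n : ℝ≥0∞) ∂M.P x := by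
        refine setLIntegral_mono' hS.compl fun ω hω => ?_
        have : |g (M.X (τ ω) ω)| ≤ n := not_lt.1 hω
        rw [← ENNReal.ofReal_natCast]
        exact ENNReal.ofReal_le_ofReal this
    _ ≤ ∫⁻ _, (n : ℝ≥0∞) ∂M.P x := setLIntegral_le_lintegral _ _
    _ = n := by simp

lemma exists_lintegral_terminal_le {g : E → ℝ} (hg : Continuous g) {T : ℝ≥0} {K : Set E}
    (hK : M.SupUniformlyIntegrableOn g T K) {t : ℝ≥0} (htT : t ≤ T) :
    ∃ n : ℕ, ∀ x ∈ K, ∀ τ ∈ M.stoppingTimes t,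
      ∫⁻ ω, ENNReal.ofReal |g (M.X (τ ω) ω)| ∂M.P x ≤ n + 1 := by
  obtain ⟨n, hn⟩ := (hK.eventually (gt_mem_nhds zero_lt_one)).exists
  refine ⟨n, fun x hx τ hτ => (lintegral_terminal_le hg htT hτ n x).trans ?_⟩
  gcongr
  exact (le_iSup₂_of_le x hx le_rfl).trans hn.le

lemma integrable_terminal_of_lintegral {g : E → ℝ} (hg : Continuous g) {τ : Ω → ℝ≥0}
    (hτ : Measurable τ) {n : ℕ} {x : E}
    (h : ∫⁻ ω, ENNReal.ofReal |g (M.X (τ ω) ω)| ∂M.P x ≤ n + 1) :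
    Integrable (fun ω => g (M.X (τ ω) ω)) (M.P x) := by
  refine ⟨(measurable_terminal hg hτ).aestronglyMeasurable, ?_⟩
  rw [hasFiniteIntegral_iff_norm]
  exact h.trans_lt (by finiteness)

lemma integral_terminal_le_of_lintegral {g : E → ℝ} {τ : Ω → ℝ≥0} {n : ℕ} {x : E}
    (h : ∫⁻ ω, ENNReal.ofReal |g (M.X (τ ω) ω)| ∂M.P x ≤ n + 1) :
    ∫ ω, g (M.X (τ ω) ω) ∂M.P x ≤ n + 1 := by
  refine (le_abs_self _).trans ?_
  rw [← Real.norm_eq_abs]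
  refine (norm_integral_le_lintegral_norm _).trans ?_
  have h2 : ((n : ℝ≥0∞) + 1).toReal = n + 1 := by
    rw [ENNReal.toReal_add (by simp) (by simp)]; simp
  rw [← h2]
  exact ENNReal.toReal_mono (by finiteness) h

lemma wellPosed_of_supUniformlyIntegrableOn {f g : E → ℝ} {C : ℝ} (hf : Continuous f)
    (hC : ∀ x, |f x| ≤ C) (hg : Continuous g) {T : ℝ≥0} {K : Set E}
    (hK : M.SupUniformlyIntegrableOn g T K) {t : ℝ≥0} (htT : t ≤ T) {x : E} (hx : x ∈ K) :
    (∀ τ ∈ M.stoppingTimes t, Integrable (fun ω => g (M.X (τ ω) ω)) (M.P x)) ∧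
      (∀ τ ∈ M.stoppingTimes t, Integrable (M.reward f g τ) (M.P x)) ∧
      BddAbove (M.expectedRewards f g t x) := by
  obtain ⟨n, hn⟩ := exists_lintegral_terminal_le hg hK htT
  have hint : ∀ τ ∈ M.stoppingTimes t, Integrable (fun ω => g (M.X (τ ω) ω)) (M.P x) :=
    fun τ hτ => integrable_terminal_of_lintegral hg (measurable_of_mem_stoppingTimes hτ)
      (hn x hx τ hτ)
  exact ⟨hint, fun τ hτ => integrable_reward hf hC hτ (hint τ hτ),
    bddAbove_expectedRewards hf hC hint fun τ hτ =>
      integral_terminal_le_of_lintegral (hn x hx τ hτ)⟩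

lemma tendstoUniformlyOn_truncatedValue {f g : E → ℝ} {C : ℝ} (hf : Continuous f)
    (hC : ∀ x, |f x| ≤ C) (hg : Continuous g) {T : ℝ≥0} {K : Set E}
    (hK : M.SupUniformlyIntegrableOn g T K) :
    TendstoUniformlyOn (fun (n : ℕ) (p : ℝ≥0 × E) => M.truncatedValue f g n p.1 p.2)
      (fun p => M.value f g p.1 p.2) atTop (Icc 0 T ×ˢ K) := by
  rw [Metric.tendstoUniformlyOn_iff]
  intro ε hε
  have hev := hK.eventually (gt_mem_nhds (ENNReal.ofReal_pos.2 (half_pos hε)))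
  filter_upwards [hev] with n hn
  rintro ⟨t, x⟩ ⟨ht, hx⟩
  refine lt_of_le_of_lt ?_ (half_lt_self hε)
  rw [Real.dist_eq]
  obtain ⟨hint, -, hbdd⟩ := wellPosed_of_supUniformlyIntegrableOn hf hC hg hK ht.2 hx
  refine abs_sSup_image_sub_le (stoppingTimes_nonempty t) hbdd fun τ hτ => ?_
  have hτm := measurable_of_mem_stoppingTimes hτ
  have hint' := integrable_terminal_of_bound (M := M) (continuous_truncation hg n)
    (abs_truncation_le g n) hτm x
  rw [integral_reward hf hC hτ (hint τ hτ), integral_reward hf hC hτ hint', add_sub_add_left_eq_sub,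
    ← integral_sub (hint τ hτ) hint']
  have hS : MeasurableSet {ω | (n : ℝ) < |g (M.X (τ ω) ω)|} :=
    measurableSet_lt measurable_const (measurable_terminal hg hτm).norm
  rw [← Real.norm_eq_abs]
  refine (norm_integral_le_lintegral_norm _).trans ?_
  refine ENNReal.toReal_le_of_le_ofReal (half_pos hε).le ?_
  calc _ ≤ ∫⁻ ω in {ω | (n : ℝ) < |g (M.X (τ ω) ω)|},
            ENNReal.ofReal |g (M.X (τ ω) ω)| ∂M.P x := by
        rw [← lintegral_indicator hS]
        refine lintegral_mono fun ω => ?_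
        have h1 := abs_sub_truncation_le (g (M.X (τ ω) ω)) n
        simp only [indicator, mem_ofPred_eq, Real.norm_eq_abs]
        split_ifs at h1 ⊢ with h
        · exact ENNReal.ofReal_le_ofReal h1
        · simpa using h1
    _ ≤ _ := lintegral_tail_le ht.2 hτ n x
    _ ≤ _ := (le_iSup₂_of_le (f := fun y (_ : y ∈ K) => ∫⁻ ω in {ω | (n : ℝ≥0∞) <
        M.runningSup g T ω}, M.runningSup g T ω ∂(M.P y)) x hx le_rfl).trans hn.le

end MarkovProcess

/-! ### The Markov property for functions -/

namespace MarkovProcess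

variable {E Ω : Type*} [MetricSpace E] [MeasurableSpace E] [BorelSpace E]
  [mΩ : MeasurableSpace Ω] (M : MarkovProcess E Ω)

/-- The transition kernel `P_t(x, ·)`. -/
def kernel (t : ℝ≥0) : Kernel E E where
  toFun x := (M.P x).map (M.X t)
  measurable' := by
    refine Measure.measurable_of_measurable_coe _ fun B hB => ?_
    simp only [Measure.map_apply (M.measurable_X t) hB]
    exact M.measurable_transition t B hB

instance (t : ℝ≥0) : IsMarkovKernel (M.kernel t) :=
  ⟨fun _ => Measure.isProbabilityMeasure_map (M.measurable_X t).aemeasurable⟩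

lemma integral_kernel {φ : E → ℝ} (hφ : Continuous φ) (t : ℝ≥0) (x : E) :
    ∫ y, φ y ∂M.kernel t x = ∫ ω, φ (M.X t ω) ∂M.P x :=
  integral_map (M.measurable_X t).aemeasurable hφ.measurable.aestronglyMeasurable

/-- The Markov property on A ∈ F_s as an identity of measures on E, from which it passes from Borel
sets to functions. -/
lemma map_restrict_eq_comp (x : E) (s t : ℝ≥0) {A : Set Ω} (hA : MeasurableSet[M.filtration s] A) :
    ((M.P x).restrict A).map (M.X (s + t)) =
      (M.kernel t) ∘ₘ (((M.P x).restrict A).map (M.X s)) := by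
  ext B hB
  rw [Measure.bind_apply hB (M.kernel t).aemeasurable,
    lintegral_map ((M.kernel t).measurable_coe hB) (M.measurable_X s),
    Measure.map_apply (M.measurable_X _) hB, Measure.restrict_apply (M.measurable_X _ hB),
    inter_comm, M.markov x s t A B hA hB]
  refine lintegral_congr fun ω => ?_
  exact (Measure.map_apply (M.measurable_X t) hB).symm

lemma measurable_integral_X {φ : E → ℝ} (hφ : Continuous φ) (t : ℝ≥0) :
    Measurable fun x => ∫ ω, φ (M.X t ω) ∂M.P x := by
  have := (hφ.measurable.stronglyMeasurable.integral_kernel (κ := M.kernel t)).measurable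
  simpa only [M.integral_kernel hφ] using this

lemma abs_integral_X_le {φ : E → ℝ} {C : ℝ} (hC : ∀ x, |φ x| ≤ C) (t : ℝ≥0) (x : E) :
    |∫ ω, φ (M.X t ω) ∂M.P x| ≤ C := by
  have := norm_integral_le_of_norm_le_const (μ := M.P x) (f := fun ω => φ (M.X t ω))
    (Eventually.of_forall fun ω => hC _)
  simpa using this

lemma setIntegral_markov {φ : E → ℝ} {C : ℝ} (hφ : Continuous φ) (hC : ∀ x, |φ x| ≤ C) (x : E)
    (s t : ℝ≥0) {A : Set Ω} (hA : MeasurableSet[M.filtration s] A) :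
    ∫ ω in A, φ (M.X (s + t) ω) ∂M.P x =
      ∫ ω in A, (∫ ω', φ (M.X t ω') ∂M.P (M.X s ω)) ∂M.P x := by
  have h1 : ∫ ω in A, φ (M.X (s + t) ω) ∂M.P x =
      ∫ y, φ y ∂(((M.P x).restrict A).map (M.X (s + t))) :=
    (integral_map (M.measurable_X _).aemeasurable hφ.measurable.aestronglyMeasurable).symm
  have h2 := Kernel.integral_comp (a := ()) (η := M.kernel t) (f := φ)
    (κ := Kernel.const Unit (((M.P x).restrict A).map (M.X s)))
  simp only [Kernel.comp_apply, Kernel.const_apply] at h2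
  rw [h1, map_restrict_eq_comp M x s t hA, h2]
  · simp only [M.integral_kernel hφ]
    exact integral_map (M.measurable_X s).aemeasurable
      (M.measurable_integral_X hφ t).aestronglyMeasurable
  · exact Integrable.of_bound hφ.measurable.aestronglyMeasurable C (Eventually.of_forall hC)

lemma condExp_markov {φ : E → ℝ} {C : ℝ} (hφ : Continuous φ) (hC : ∀ x, |φ x| ≤ C) (x : E)
    (s t : ℝ≥0) :
    (fun ω => ∫ ω', φ (M.X t ω') ∂M.P (M.X s ω)) =ᵐ[M.P x]
      (M.P x)[fun ω => φ (M.X (s + t) ω) | M.filtration s] := by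
  have hm : Measurable[M.filtration s] fun ω => ∫ ω', φ (M.X t ω') ∂M.P (M.X s ω) :=
    (M.measurable_integral_X hφ t).comp (M.adapted s)
  refine ae_eq_condExp_of_forall_setIntegral_eq (M.filtration.le s) ?_ (fun A _ _ => ?_)
    (fun A hA _ => (M.setIntegral_markov hφ hC x s t hA).symm)
    hm.stronglyMeasurable.aestronglyMeasurable
  · exact Integrable.of_bound (hφ.measurable.comp (M.measurable_X _)).aestronglyMeasurable C
      (Eventually.of_forall fun _ => hC _)
  · exact (Integrable.of_bound (hm.mono (M.filtration.le s) le_rfl).aestronglyMeasurable C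
      (Eventually.of_forall fun _ => M.abs_integral_X_le hC t _)).integrableOn

/-- Needed for the cross term when the square of an increment is expanded: ψ(X_s) is F_s-measurable
and can be pulled out of the conditional expectation. -/
lemma setIntegral_mul_markov {φ ψ : E → ℝ} {C D : ℝ} (hφ : Continuous φ) (hC : ∀ x, |φ x| ≤ C)
    (hψ : Continuous ψ) (hD : ∀ x, |ψ x| ≤ D) (x : E) (s t : ℝ≥0) {A : Set Ω}
    (hA : MeasurableSet[M.filtration s] A) :
    ∫ ω in A, ψ (M.X s ω) * φ (M.X (s + t) ω) ∂M.P x =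
      ∫ ω in A, ψ (M.X s ω) * (∫ ω', φ (M.X t ω') ∂M.P (M.X s ω)) ∂M.P x := by
  have hψm : Measurable[M.filtration s] fun ω => ψ (M.X s ω) := hψ.measurable.comp (M.adapted s)
  have hφi : Integrable (fun ω => φ (M.X (s + t) ω)) (M.P x) :=
    Integrable.of_bound (hφ.measurable.comp (M.measurable_X _)).aestronglyMeasurable C
      (Eventually.of_forall fun _ => hC _)
  have hi : Integrable ((fun ω => ψ (M.X s ω)) * fun ω => φ (M.X (s + t) ω)) (M.P x) :=
    hφi.bdd_mul (c := D) (hψ.measurable.comp (M.measurable_X _)).aestronglyMeasurable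
      (Eventually.of_forall fun _ => hD _)
  have h1 := condExp_mul_of_stronglyMeasurable_left hψm.stronglyMeasurable hi hφi
  have h2 := M.condExp_markov hφ hC x s t
  change ∫ ω in A, ((fun ω => ψ (M.X s ω)) * fun ω => φ (M.X (s + t) ω)) ω ∂M.P x = _
  rw [← setIntegral_condExp (M.filtration.le s) hi hA]
  refine integral_congr_ae (ae_restrict_of_ae ?_)
  filter_upwards [h1, h2] with ω h1 h2
  rw [h1, Pi.mul_apply, h2]

end MarkovProcess

/-! ### The one-point compactification -/

lemma isCountablyGenerated_cocompact (X : Type*) [TopologicalSpace X] [WeaklyLocallyCompactSpace X]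
    [SigmaCompactSpace X] : (cocompact X).IsCountablyGenerated := by
  let K : CompactExhaustion X := default
  have hb : (cocompact X).HasBasis (fun _ : ℕ => True) fun n => (K n)ᶜ := by
    refine hasBasis_cocompact.to_hasBasis (fun s hs => ?_) fun n _ => ⟨K n, K.isCompact n, le_rfl⟩
    obtain ⟨n, hn⟩ := K.exists_superset_of_isCompact hs
    exact ⟨n, trivial, compl_subset_compl.2 hn⟩
  exact HasCountableBasis.isCountablyGenerated ⟨hb, to_countable _⟩

/-- σ-compactness gives a countable neighbourhood base at infinity. First countability is what lets
dominated convergence prove continuity of the resolvent. -/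
lemma firstCountableTopology_onePoint (X : Type*) [TopologicalSpace X] [T2Space X]
    [FirstCountableTopology X] [WeaklyLocallyCompactSpace X] [SigmaCompactSpace X] :
    FirstCountableTopology (OnePoint X) := by
  refine ⟨fun y => ?_⟩
  induction y using OnePoint.rec with
  | infty =>
    have := isCountablyGenerated_cocompact X
    rw [OnePoint.nhds_infty_eq, coclosedCompact_eq_cocompact]
    infer_instance
  | coe x =>
    rw [OnePoint.nhds_coe_eq]
    infer_instance

namespace MarkovProcess

variable {E Ω : Type*} [MetricSpace E] [MeasurableSpace E] [BorelSpace E]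
  [mΩ : MeasurableSpace Ω] {M : MarkovProcess E Ω}

lemma abs_coe_le (φ : C(OnePoint E, ℝ)) (x : E) : |φ x| ≤ ‖φ‖ := φ.norm_coe_le_norm _

lemma continuous_coe (φ : C(OnePoint E, ℝ)) : Continuous fun x : E => φ x :=
  φ.continuous.comp OnePoint.continuous_coe

lemma integrable_coe (φ : C(OnePoint E, ℝ)) (t : ℝ≥0) (x : E) :
    Integrable (fun ω => φ (M.X t ω)) (M.P x) :=
  Integrable.of_bound ((continuous_coe φ).measurable.comp (M.measurable_X _)).aestronglyMeasurable _
    (Eventually.of_forall fun _ => abs_coe_le φ _)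

/-- The transition operators extended to `C(OnePoint E, ℝ)`; the point at infinity is absorbing. -/
def extendedOperator (hM : M.WeakFeller) (t : ℝ≥0) (φ : C(OnePoint E, ℝ)) : C(OnePoint E, ℝ) where
  toFun y := y.elim (φ OnePoint.infty) fun x => ∫ ω, φ (M.X t ω) ∂M.P x
  continuous_toFun := by
    -- Subtracting the value at infinity lands in C₀, where the weak Feller property applies; the
    -- constant is restored because the laws have total mass one.
    let φ₀ : C₀(E, ℝ) :=
      { toFun := fun x => φ x - φ OnePoint.infty
        continuous_toFun := (continuous_coe φ).sub continuous_const
        zero_at_infty' := by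
          have h := (φ.continuous.tendsto OnePoint.infty).comp OnePoint.tendsto_coe_infty
          rw [coclosedCompact_eq_cocompact] at h
          simpa using h.sub_const (φ OnePoint.infty) }
    obtain ⟨ψ, hψ⟩ := hM t φ₀
    have h1 : ∀ x, ∫ ω, φ (M.X t ω) ∂M.P x = ψ x + φ OnePoint.infty := fun x => by
      have h2 : ∫ ω, φ₀ (M.X t ω) ∂M.P x =
          ∫ ω, (φ (M.X t ω) - φ OnePoint.infty) ∂M.P x := rfl
      rw [hψ, h2, integral_sub (integrable_coe φ t x) (integrable_const _)]
      simp
    rw [OnePoint.continuous_iff, coclosedCompact_eq_cocompact]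
    simp only [OnePoint.elim_some, OnePoint.elim_infty, h1]
    constructor
    · simpa using ψ.zero_at_infty'.add_const (φ OnePoint.infty)
    · exact ψ.continuous.add continuous_const

lemma extendedOperator_coe (hM : M.WeakFeller) (t : ℝ≥0) (φ : C(OnePoint E, ℝ)) (x : E) :
    extendedOperator hM t φ x = ∫ ω, φ (M.X t ω) ∂M.P x := rfl

lemma extendedOperator_infty (hM : M.WeakFeller) (t : ℝ≥0) (φ : C(OnePoint E, ℝ)) :
    extendedOperator hM t φ OnePoint.infty = φ OnePoint.infty := rfl

/-- The Feller semigroup on `C(OnePoint E, ℝ)` of a weakly Feller process. -/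
def fellerSemigroup [MeasurableSpace (OnePoint E)] [BorelSpace (OnePoint E)] (hM : M.WeakFeller) :
    FellerSemigroup (OnePoint E) where
  Q := extendedOperator hM
  κ t y := y.elim (Measure.dirac OnePoint.infty) fun x => (M.P x).map fun ω => (M.X t ω : OnePoint E)
  prob t y := by
    induction y using OnePoint.rec with
    | infty => exact Measure.dirac.isProbabilityMeasure
    | coe x =>
      exact Measure.isProbabilityMeasure_map (μ := M.P x)
        (OnePoint.continuous_coe.measurable.comp (M.measurable_X t)).aemeasurable
  apply_eq t φ y := by
    induction y using OnePoint.rec with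
    | infty =>
      rw [extendedOperator_infty, OnePoint.elim_infty,
        integral_dirac' _ _ φ.continuous.measurable.stronglyMeasurable]
    | coe x =>
      exact (integral_map (μ := M.P x)
        (OnePoint.continuous_coe.measurable.comp (M.measurable_X t)).aemeasurable
        φ.continuous.measurable.aestronglyMeasurable).symm
  zero φ := by
    ext y
    induction y using OnePoint.rec with
    | infty => rfl
    | coe x =>
      rw [extendedOperator_coe]
      have h : ∫ ω, φ (M.X 0 ω) ∂M.P x = ∫ _, φ x ∂M.P x := by
        refine integral_congr_ae ?_
        filter_upwards [M.initial x] with ω hω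
        rw [hω]
      simp [h]
  add s t φ := by
    ext y
    induction y using OnePoint.rec with
    | infty => rfl
    | coe x =>
      have := M.setIntegral_markov (continuous_coe φ) (abs_coe_le φ) x s t MeasurableSet.univ
      rw [setIntegral_univ, setIntegral_univ] at this
      exact this
  rightCont φ y t := by
    induction y using OnePoint.rec with
    | infty => exact continuousWithinAt_const
    | coe x =>
      refine continuousWithinAt_of_dominated (bound := fun _ => ‖φ‖)
        (Eventually.of_forall fun s => (integrable_coe φ s x).aestronglyMeasurable)
        (Eventually.of_forall fun s => Eventually.of_forall fun ω => abs_coe_le φ _)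
        (integrable_const _) (Eventually.of_forall fun ω => ?_)
      exact M.rightCont_comp (continuous_coe φ) ω t

end MarkovProcess

/-! ### The dynamic programming operator -/

namespace FellerSemigroup

variable {Y : Type*} [TopologicalSpace Y] [CompactSpace Y] [MeasurableSpace Y]
  [OpensMeasurableSpace Y] (S : FellerSemigroup Y)

/-- `∫_0^h Q_r F dr`. -/
def runningIntegral (F : C(Y, ℝ)) (h : ℝ≥0) : C(Y, ℝ) :=
  ∫ r in (0 : ℝ)..(h : ℝ), S.Q r.toNNReal F

/-- One step of dynamic programming, with time step `h`. -/
def dpStep (F G : C(Y, ℝ)) (h : ℝ≥0) (u : C(Y, ℝ)) : C(Y, ℝ) :=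
  G ⊔ (S.runningIntegral F h + S.Q h u)

/-- The value function of the stopping problem restricted to the times `0, h, …, n h`. -/
def dpValue (F G : C(Y, ℝ)) (h : ℝ≥0) : ℕ → C(Y, ℝ)
  | 0 => G
  | n + 1 => S.dpStep F G h (dpValue F G h n)

lemma dpValue_succ_apply (F G : C(Y, ℝ)) (h : ℝ≥0) (n : ℕ) (y : Y) :
    S.dpValue F G h (n + 1) y =
      max (G y) (S.runningIntegral F h y + S.Q h (S.dpValue F G h n) y) := rfl

/-- The second moment `∫ (G z - G y)² κ_r(y, dz)` of an increment. -/
def squareIncrement (G : C(Y, ℝ)) (r : ℝ≥0) : C(Y, ℝ) :=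
  S.Q r (G * G) - (2 : ℝ) • (G * S.Q r G) + G * G

variable [T2Space Y] [FirstCountableTopology Y]

lemma continuous_Q (F : C(Y, ℝ)) : Continuous fun t => S.Q t F :=
  S.strongly_continuous.comp (continuous_id.prodMk continuous_const)

lemma continuous_Q_toNNReal (F : C(Y, ℝ)) : Continuous fun r : ℝ => S.Q r.toNNReal F :=
  (S.continuous_Q F).comp continuous_real_toNNReal

lemma runningIntegral_apply (F : C(Y, ℝ)) (h : ℝ≥0) (y : Y) :
    S.runningIntegral F h y = ∫ r in (0 : ℝ)..(h : ℝ), S.Q r.toNNReal F y := by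
  rw [runningIntegral, intervalIntegral.integral_of_le h.coe_nonneg,
    intervalIntegral.integral_of_le h.coe_nonneg, ContinuousMap.integral_apply]
  exact ((S.continuous_Q_toNNReal F).intervalIntegrable 0 h).1

lemma continuous_runningIntegral (F : C(Y, ℝ)) : Continuous fun h => S.runningIntegral F h :=
  (intervalIntegral.continuous_primitive
    (fun a b => (S.continuous_Q_toNNReal F).intervalIntegrable a b) 0).comp NNReal.continuous_coe

/-- The step h enters both the operator and its argument, so joint continuity of (h, u) ↦ Q_h u is
used. -/
lemma continuous_dpValue (F G : C(Y, ℝ)) (n : ℕ) : Continuous fun h => S.dpValue F G h n := by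
  induction n with
  | zero => exact continuous_const
  | succ n ih =>
    have h1 : Continuous fun h => S.runningIntegral F h + S.Q h (S.dpValue F G h n) :=
      (S.continuous_runningIntegral F).add (S.strongly_continuous.comp (continuous_id.prodMk ih))
    refine ContinuousMap.continuous_of_continuous_uncurry _ ?_
    exact (G.continuous.comp continuous_snd).max ((h1.comp continuous_fst).eval continuous_snd)

/-- The second moment is norm-continuous in r and equals G² - 2G² + G² = 0 at r = 0. -/
lemma exists_norm_squareIncrement_le (G : C(Y, ℝ)) {ε : ℝ} (hε : 0 < ε) :
    ∃ η : ℝ≥0, 0 < η ∧ ∀ r ≤ η, ‖S.squareIncrement G r‖ ≤ ε := by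
  have hc : Continuous fun r => ‖S.squareIncrement G r‖ := by
    unfold squareIncrement
    have := S.continuous_Q (G * G)
    have := S.continuous_Q G
    fun_prop
  have h0 : S.squareIncrement G 0 = 0 := by
    ext y
    simp [squareIncrement, S.zero]
    ring
  have hev : ∀ᶠ r in 𝓝 (0 : ℝ≥0), ‖S.squareIncrement G r‖ < ε := by
    have := hc.tendsto 0
    rw [h0, norm_zero] at this
    exact this.eventually (gt_mem_nhds hε)
  obtain ⟨η, hη, hsub⟩ := Metric.nhds_basis_closedBall.eventually_iff.1 hev
  refine ⟨⟨η, hη.le⟩, hη, fun r hr => (hsub ?_).le⟩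
  have : (r : ℝ) ≤ η := hr
  simpa [NNReal.dist_eq] using this

end FellerSemigroup

/-! ### Dynamic programming values as optimal rewards over stopping times on a grid -/

namespace MarkovProcess

variable {E Ω : Type*} [MetricSpace E] [MeasurableSpace E] [BorelSpace E]
  [mΩ : MeasurableSpace Ω] {M : MarkovProcess E Ω}

/-- The reward `∫_a^τ f(X_s) ds + g(X_τ)` collected from time `a` on. -/
def rewardFrom (M : MarkovProcess E Ω) (f g : E → ℝ) (a : ℝ≥0) (τ : Ω → ℝ≥0) (ω : Ω) : ℝ :=
  (∫ s in (a : ℝ)..(τ ω : ℝ), f (M.X s.toNNReal ω)) + g (M.X (τ ω) ω)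

lemma rewardFrom_zero (f g : E → ℝ) (τ : Ω → ℝ≥0) : M.rewardFrom f g 0 τ = M.reward f g τ := by
  ext ω; simp [rewardFrom, reward]

lemma integrable_rewardFrom {f g : E → ℝ} {C D : ℝ} (hf : Continuous f) (hC : ∀ x, |f x| ≤ C)
    (hg : Continuous g) (hD : ∀ x, |g x| ≤ D) {a t : ℝ≥0} (hat : a ≤ t) {τ : Ω → ℝ≥0}
    (hτ : τ ∈ M.stoppingTimes t) (x : E) : Integrable (M.rewardFrom f g a τ) (M.P x) :=
  (integrable_integral_running (σ := fun _ => a) hf hC measurable_const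
    (measurable_of_mem_stoppingTimes hτ) (fun _ => hat) hτ.2 x).add
    (integrable_terminal_of_bound hg hD (measurable_of_mem_stoppingTimes hτ) x)

lemma rewardFrom_split {f g : E → ℝ} {C : ℝ} (hf : Continuous f) (hC : ∀ x, |f x| ≤ C)
    (a b : ℝ≥0) (τ : Ω → ℝ≥0) (ω : Ω) :
    M.rewardFrom f g a τ ω =
      (∫ s in (a : ℝ)..(b : ℝ), f (M.X s.toNNReal ω)) + M.rewardFrom f g b τ ω := by
  rw [rewardFrom, rewardFrom, ← add_assoc, intervalIntegral.integral_add_adjacent_intervals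
    (intervalIntegrable_running hf hC ω _ _) (intervalIntegrable_running hf hC ω _ _)]

variable [MeasurableSpace (OnePoint E)] [BorelSpace (OnePoint E)]

lemma setIntegral_Q (hM : M.WeakFeller) (φ : C(OnePoint E, ℝ)) (x : E) (s t : ℝ≥0) {A : Set Ω}
    (hA : MeasurableSet[M.filtration s] A) :
    ∫ ω in A, φ (M.X (s + t) ω) ∂M.P x =
      ∫ ω in A, (fellerSemigroup hM).Q t φ (M.X s ω) ∂M.P x :=
  M.setIntegral_markov (continuous_coe φ) (abs_coe_le φ) x s t hA

variable [FirstCountableTopology (OnePoint E)] [LocallyCompactSpace E]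

/-- Shift time by s, exchange integrals by Fubini and apply the Markov property at each fixed r. -/
lemma setIntegral_running (hM : M.WeakFeller) (F : C(OnePoint E, ℝ)) (x : E) (s h : ℝ≥0)
    {A : Set Ω} (hA : MeasurableSet[M.filtration s] A) :
    ∫ ω in A, (∫ r in (s : ℝ)..((s + h : ℝ≥0) : ℝ), F (M.X r.toNNReal ω)) ∂M.P x =
      ∫ ω in A, (fellerSemigroup hM).runningIntegral F h (M.X s ω) ∂M.P x := by
  have hshift : ∀ ω, ∫ r in (s : ℝ)..((s + h : ℝ≥0) : ℝ), F (M.X r.toNNReal ω) =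
      ∫ r in (0 : ℝ)..(h : ℝ), F (M.X ((s : ℝ) + r).toNNReal ω) := fun ω => by
    rw [intervalIntegral.integral_comp_add_left (fun r => (F (M.X r.toNNReal ω) : ℝ)) (s : ℝ)]
    simp
  simp only [hshift, FellerSemigroup.runningIntegral_apply]
  have hm1 : Measurable fun p : ℝ × Ω => F (M.X ((s : ℝ) + p.1).toNNReal p.2) :=
    (measurable_running (continuous_coe F)).comp (f := fun p : ℝ × Ω => ((s : ℝ) + p.1, p.2))
      ((measurable_const.add measurable_fst).prodMk measurable_snd)
  have hm2 : Measurable fun p : ℝ × Ω => (fellerSemigroup hM).Q p.1.toNNReal F (M.X s p.2) :=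
    ((fellerSemigroup hM).measurable_uncurry F).comp
      (f := fun p : ℝ × Ω => (p.1.toNNReal, (M.X s p.2 : OnePoint E)))
      ((measurable_real_toNNReal.comp measurable_fst).prodMk
        (OnePoint.continuous_coe.measurable.comp ((M.measurable_X s).comp measurable_snd)))
  rw [← intervalIntegral_integral_swap, ← intervalIntegral_integral_swap]
  · refine intervalIntegral.integral_congr fun r hr => ?_
    have hr0 : 0 ≤ r := by
      rw [uIcc_of_le h.coe_nonneg] at hr
      exact hr.1
    have h1 : ((s : ℝ) + r).toNNReal = s + r.toNNReal := by
      rw [Real.toNNReal_add s.coe_nonneg hr0, Real.toNNReal_coe]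
    simp only [h1]
    exact setIntegral_Q hM F x s r.toNNReal hA
  · rw [uIoc_of_le h.coe_nonneg]
    exact Integrable.of_bound hm2.aestronglyMeasurable ‖F‖ (Eventually.of_forall fun p =>
      (ContinuousMap.norm_coe_le_norm _ _).trans ((fellerSemigroup hM).norm_le _ F))
  · rw [uIoc_of_le h.coe_nonneg]
    exact Integrable.of_bound hm1.aestronglyMeasurable ‖F‖ (Eventually.of_forall fun p =>
      abs_coe_le F _)

lemma setIntegral_running_add (hM : M.WeakFeller) (F u : C(OnePoint E, ℝ)) (x : E) (s h : ℝ≥0)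
    {A : Set Ω} (hA : MeasurableSet[M.filtration s] A) :
    ∫ ω in A, (∫ r in (s : ℝ)..((s + h : ℝ≥0) : ℝ), F (M.X r.toNNReal ω)) ∂M.P x +
      ∫ ω in A, u (M.X (s + h) ω) ∂M.P x =
      ∫ ω in A, ((fellerSemigroup hM).runningIntegral F h (M.X s ω) +
        (fellerSemigroup hM).Q h u (M.X s ω)) ∂M.P x := by
  rw [setIntegral_running hM F x s h hA, setIntegral_Q hM u x s h hA, integral_add]
  · exact (integrable_coe _ s x).integrableOn
  · exact (integrable_coe _ s x).integrableOn

/-- A grid-valued stopping time collects at most the dynamic programming value. -/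
lemma setIntegral_rewardFrom_le_dpValue (hM : M.WeakFeller) (F G : C(OnePoint E, ℝ)) (x : E)
    (h : ℝ≥0) (N : ℕ) {τ : Ω → ℝ≥0} (hτ : τ ∈ M.stoppingTimes (N * h))
    (hgrid : ∀ ω, ∃ k : ℕ, τ ω = k * h) (j k : ℕ) (hjk : k + j = N) {A : Set Ω}
    (hA : MeasurableSet[M.filtration (k * h)] A) (hAτ : ∀ ω ∈ A, k * h ≤ τ ω) :
    ∫ ω in A, M.rewardFrom (fun y => F y) (fun y => G y) (k * h) τ ω ∂M.P x ≤
      ∫ ω in A, (fellerSemigroup hM).dpValue F G h j (M.X (k * h) ω) ∂M.P x := by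
  have hterm : ∀ {k : ℕ} {ω}, τ ω = k * h →
      M.rewardFrom (fun y => F y) (fun y => G y) (k * h) τ ω = G (M.X (k * h) ω) := by
    intro k ω hω
    simp [rewardFrom, hω]
  induction j generalizing k A with
  | zero =>
    obtain rfl : k = N := by simpa using hjk
    refine (setIntegral_congr_fun (M.filtration.le _ _ hA) fun ω hω => ?_).le
    exact hterm (le_antisymm (hτ.2 ω) (hAτ ω hω))
  | succ j ih =>
    have hkN : ((k + 1 : ℕ) : ℝ≥0) * h ≤ N * h := by
      gcongr
      omega
    have hk1 : ((k + 1 : ℕ) : ℝ≥0) * h = k * h + h := by push_cast; ring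
    have hkN' : (k : ℝ≥0) * h ≤ N * h := le_trans (by rw [hk1]; exact le_self_add) hkN
    -- On A ∩ D one has τ = kh, so the reward is G; on A \ D the grid forces τ ≥ (k+1)h and the
    -- induction hypothesis applies.
    set D : Set Ω := {ω | τ ω ≤ k * h} with hDdef
    have hD : MeasurableSet[M.filtration (k * h)] D := measurableSet_le_of_mem hτ _
    have hD' := M.filtration.le _ _ hD
    have hA' := M.filtration.le _ _ hA
    have hint := integrable_rewardFrom (M := M) (continuous_coe F) (abs_coe_le F)
      (continuous_coe G) (abs_coe_le G) hkN' hτ x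
    have hV : Integrable (fun ω => (fellerSemigroup hM).dpValue F G h (j + 1) (M.X (k * h) ω))
      (M.P x) := integrable_coe _ _ _
    rw [← integral_inter_add_sdiff hD' hint.integrableOn,
      ← integral_inter_add_sdiff hD' hV.integrableOn]
    refine add_le_add ?_ ?_
    · refine setIntegral_mono_on hint.integrableOn hV.integrableOn (hA'.inter hD') fun ω hω => ?_
      rw [hterm (le_antisymm hω.2 (hAτ ω hω.1)), FellerSemigroup.dpValue_succ_apply]
      exact le_max_left _ _
    · have hB : MeasurableSet[M.filtration (k * h)] (A \ D) := hA.diff hD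
      have hBτ : ∀ ω ∈ A \ D, ((k + 1 : ℕ) : ℝ≥0) * h ≤ τ ω := fun ω hω => by
        obtain ⟨l, hl⟩ := hgrid ω
        have h1 : (k : ℝ≥0) * h < l * h := by rw [← hl]; exact not_le.1 hω.2
        have h2 : (k : ℝ≥0) < l := lt_of_mul_lt_mul_right h1 zero_le
        rw [hl]
        gcongr
        exact_mod_cast h2
      have hB1 : MeasurableSet[M.filtration ((k + 1 : ℕ) * h)] (A \ D) :=
        M.filtration.mono (by rw [hk1]; exact le_self_add) _ hB
      have hih := ih (k + 1) (by omega) hB1 hBτ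
      have hint1 := integrable_rewardFrom (M := M) (continuous_coe F) (abs_coe_le F)
        (continuous_coe G) (abs_coe_le G) hkN hτ x
      have hrun := integrable_integral_running (M := M) (t := N * h) (σ := fun _ => k * h)
        (τ := fun _ => (k + 1 : ℕ) * h)
        (continuous_coe F) (abs_coe_le F) measurable_const measurable_const (fun _ => hkN')
        (fun _ => hkN) x
      calc ∫ ω in A \ D, M.rewardFrom (fun y => F y) (fun y => G y) (k * h) τ ω ∂M.P x
          = ∫ ω in A \ D, (∫ s in ((k * h : ℝ≥0) : ℝ)..(((k + 1 : ℕ) * h : ℝ≥0) : ℝ),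
                F (M.X s.toNNReal ω)) ∂M.P x +
              ∫ ω in A \ D, M.rewardFrom (fun y => F y) (fun y => G y) ((k + 1 : ℕ) * h) τ ω
                ∂M.P x := by
            rw [← integral_add hrun.integrableOn hint1.integrableOn]
            exact integral_congr_ae (Eventually.of_forall fun ω =>
              rewardFrom_split (continuous_coe F) (abs_coe_le F) _ _ τ ω)
        _ ≤ ∫ ω in A \ D, (∫ s in ((k * h : ℝ≥0) : ℝ)..(((k + 1 : ℕ) * h : ℝ≥0) : ℝ),
                F (M.X s.toNNReal ω)) ∂M.P x +
              ∫ ω in A \ D, (fellerSemigroup hM).dpValue F G h j (M.X ((k + 1 : ℕ) * h) ω)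
                ∂M.P x := by
            gcongr
        _ = ∫ ω in A \ D, ((fellerSemigroup hM).runningIntegral F h (M.X (k * h) ω) +
              (fellerSemigroup hM).Q h ((fellerSemigroup hM).dpValue F G h j) (M.X (k * h) ω))
                ∂M.P x := by
            simp only [hk1]
            exact setIntegral_running_add hM F _ x _ h hB
        _ ≤ _ := by
            refine setIntegral_mono ?_ hV.integrableOn fun ω => ?_
            · exact ((integrable_coe _ _ x).add (integrable_coe _ _ x)).integrableOn
            · exact le_max_right _ _

/-- Stopping when the dynamic programming value equals the terminal reward is optimal. -/
lemma exists_setIntegral_rewardFrom_eq_dpValue (hM : M.WeakFeller) (F G : C(OnePoint E, ℝ))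
    (h : ℝ≥0) (N : ℕ) (j k : ℕ) (hjk : k + j = N) :
    ∃ σ ∈ M.stoppingTimes (N * h), (∀ ω, k * h ≤ σ ω) ∧
      ∀ (x : E) (A : Set Ω), MeasurableSet[M.filtration (k * h)] A →
        ∫ ω in A, M.rewardFrom (fun y => F y) (fun y => G y) (k * h) σ ω ∂M.P x =
          ∫ ω in A, (fellerSemigroup hM).dpValue F G h j (M.X (k * h) ω) ∂M.P x := by
  have hterm : ∀ {k : ℕ} {ω} {τ : Ω → ℝ≥0}, τ ω = k * h →
      M.rewardFrom (fun y => F y) (fun y => G y) (k * h) τ ω = G (M.X (k * h) ω) := by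
    intro k ω τ hω
    simp [rewardFrom, hω]
  induction j generalizing k with
  | zero =>
    obtain rfl : k = N := by simpa using hjk
    refine ⟨fun _ => k * h, const_mem_stoppingTimes le_rfl, fun _ => le_rfl, fun x A hA => ?_⟩
    exact setIntegral_congr_fun (M.filtration.le _ _ hA) fun ω _ => hterm rfl
  | succ j ih =>
    classical
    obtain ⟨σ, hσ, hkσ, hσeq⟩ := ih (k + 1) (by omega)
    have hkN : ((k + 1 : ℕ) : ℝ≥0) * h ≤ N * h := by
      gcongr
      omega
    have hk1 : ((k + 1 : ℕ) : ℝ≥0) * h = k * h + h := by push_cast; ring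
    have hkk : (k : ℝ≥0) * h ≤ (k + 1 : ℕ) * h := by rw [hk1]; exact le_self_add
    have hkN' : (k : ℝ≥0) * h ≤ N * h := hkk.trans hkN
    set V := (fellerSemigroup hM).dpValue F G h (j + 1) with hVdef
    -- The stopping region: V ≥ G always, so this is {V = G}; off it the maximum defining V is the
    -- continuation value.
    set D : Set Ω := {ω | V (M.X (k * h) ω) ≤ G (M.X (k * h) ω)} with hDdef
    have hD : MeasurableSet[M.filtration (k * h)] D :=
      M.adapted _ (isClosed_le (continuous_coe V) (continuous_coe G)).measurableSet
    have hD' := M.filtration.le _ _ hD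
    let σ' : Ω → ℝ≥0 := fun ω => if ω ∈ D then k * h else σ ω
    have hσ'D : ∀ ω ∈ D, σ' ω = k * h := fun ω hω => if_pos hω
    have hσ'D' : ∀ ω ∉ D, σ' ω = σ ω := fun ω hω => if_neg hω
    have hkσ' : ∀ ω, k * h ≤ σ' ω := fun ω => by
      by_cases hω : ω ∈ D
      · rw [hσ'D ω hω]
      · rw [hσ'D' ω hω]; exact hkk.trans (hkσ ω)
    have hσ' : σ' ∈ M.stoppingTimes (N * h) := by
      refine mem_stoppingTimes (fun i => ?_) fun ω => ?_
      · by_cases hi : (k : ℝ≥0) * h ≤ i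
        · have : {ω | σ' ω ≤ i} = D ∪ {ω | σ ω ≤ i} ∩ Dᶜ := by
            ext ω
            by_cases hω : ω ∈ D
            · simp [hω, hσ'D, hi]
            · simp [hω, hσ'D' ω hω]
          rw [this]
          have hDi := M.filtration.mono hi _ hD
          exact hDi.union ((measurableSet_le_of_mem hσ i).inter hDi.compl)
        · have : {ω | σ' ω ≤ i} = ∅ := by
            ext ω
            simpa using (not_le.1 hi).trans_le (hkσ' ω)
          rw [this]
          exact @MeasurableSet.empty _ (M.filtration i)
      · by_cases hω : ω ∈ D
        · rw [hσ'D ω hω]; exact hkN'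
        · rw [hσ'D' ω hω]; exact hσ.2 ω
    refine ⟨σ', hσ', hkσ', fun x A hA => ?_⟩
    have hA' := M.filtration.le _ _ hA
    have hint := integrable_rewardFrom (M := M) (continuous_coe F) (abs_coe_le F)
      (continuous_coe G) (abs_coe_le G) hkN' hσ' x
    have hV : Integrable (fun ω => V (M.X (k * h) ω)) (M.P x) := integrable_coe _ _ _
    rw [← integral_inter_add_sdiff hD' hint.integrableOn,
      ← integral_inter_add_sdiff hD' hV.integrableOn]
    congr 1
    · refine setIntegral_congr_fun (hA'.inter hD') fun ω hω => ?_
      refine (hterm (hσ'D ω hω.2)).trans (le_antisymm ?_ hω.2)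
      rw [hVdef, FellerSemigroup.dpValue_succ_apply]
      exact le_max_left _ _
    · have hB : MeasurableSet[M.filtration (k * h)] (A \ D) := hA.diff hD
      have hB1 : MeasurableSet[M.filtration ((k + 1 : ℕ) * h)] (A \ D) :=
        M.filtration.mono hkk _ hB
      have hint1 := integrable_rewardFrom (M := M) (continuous_coe F) (abs_coe_le F)
        (continuous_coe G) (abs_coe_le G) hkN hσ x
      have hrun := integrable_integral_running (M := M) (t := N * h) (σ := fun _ => k * h)
        (τ := fun _ => (k + 1 : ℕ) * h)
        (continuous_coe F) (abs_coe_le F) measurable_const measurable_const (fun _ => hkN')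
        (fun _ => hkN) x
      calc ∫ ω in A \ D, M.rewardFrom (fun y => F y) (fun y => G y) (k * h) σ' ω ∂M.P x
          = ∫ ω in A \ D, (∫ s in ((k * h : ℝ≥0) : ℝ)..(((k + 1 : ℕ) * h : ℝ≥0) : ℝ),
                F (M.X s.toNNReal ω)) ∂M.P x +
              ∫ ω in A \ D, M.rewardFrom (fun y => F y) (fun y => G y) ((k + 1 : ℕ) * h) σ ω
                ∂M.P x := by
            rw [← integral_add hrun.integrableOn hint1.integrableOn]
            refine setIntegral_congr_fun (hA'.diff hD') fun ω hω => ?_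
            have h1 : M.rewardFrom (fun y => F y) (fun y => G y) (k * h) σ' ω =
                M.rewardFrom (fun y => F y) (fun y => G y) (k * h) σ ω := by
              simp only [rewardFrom, hσ'D' ω hω.2]
            exact h1.trans (rewardFrom_split (continuous_coe F) (abs_coe_le F) _ _ σ ω)
        _ = ∫ ω in A \ D, (∫ s in ((k * h : ℝ≥0) : ℝ)..(((k + 1 : ℕ) * h : ℝ≥0) : ℝ),
                F (M.X s.toNNReal ω)) ∂M.P x +
              ∫ ω in A \ D, (fellerSemigroup hM).dpValue F G h j (M.X ((k + 1 : ℕ) * h) ω)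
                ∂M.P x := by
            rw [hσeq x _ hB1]
        _ = ∫ ω in A \ D, ((fellerSemigroup hM).runningIntegral F h (M.X (k * h) ω) +
              (fellerSemigroup hM).Q h ((fellerSemigroup hM).dpValue F G h j) (M.X (k * h) ω))
                ∂M.P x := by
            simp only [hk1]
            exact setIntegral_running_add hM F _ x _ h hB
        _ = _ := by
            refine setIntegral_congr_fun (hA'.diff hD') fun ω hω => ?_
            have h1 : G (M.X (k * h) ω) < V (M.X (k * h) ω) := not_le.1 hω.2
            rw [hVdef, FellerSemigroup.dpValue_succ_apply] at h1 ⊢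
            exact (max_eq_right ((lt_max_iff.1 h1).resolve_left (lt_irrefl _)).le).symm

lemma integral_coe_X_zero (φ : C(OnePoint E, ℝ)) (x : E) :
    ∫ ω, φ (M.X 0 ω) ∂M.P x = φ x := by
  have h : ∫ ω, φ (M.X 0 ω) ∂M.P x = ∫ _, φ x ∂M.P x := by
    refine integral_congr_ae ?_
    filter_upwards [M.initial x] with ω hω
    rw [hω]
  simp [h]

lemma integral_reward_le_dpValue (hM : M.WeakFeller) (F G : C(OnePoint E, ℝ)) (x : E)
    (h : ℝ≥0) (N : ℕ) {τ : Ω → ℝ≥0} (hτ : τ ∈ M.stoppingTimes (N * h))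
    (hgrid : ∀ ω, ∃ k : ℕ, τ ω = k * h) :
    ∫ ω, M.reward (fun y => F y) (fun y => G y) τ ω ∂M.P x ≤
      (fellerSemigroup hM).dpValue F G h N x := by
  have := setIntegral_rewardFrom_le_dpValue hM F G x h N hτ hgrid N 0 (zero_add N)
    MeasurableSet.univ fun ω _ => by simp
  simpa [rewardFrom_zero, integral_coe_X_zero] using this

lemma exists_integral_reward_eq_dpValue (hM : M.WeakFeller) (F G : C(OnePoint E, ℝ)) (h : ℝ≥0)
    (N : ℕ) : ∃ σ ∈ M.stoppingTimes (N * h), ∀ x : E,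
      ∫ ω, M.reward (fun y => F y) (fun y => G y) σ ω ∂M.P x =
        (fellerSemigroup hM).dpValue F G h N x := by
  obtain ⟨σ, hσ, -, h1⟩ := exists_setIntegral_rewardFrom_eq_dpValue hM F G h N N 0 (zero_add N)
  refine ⟨σ, hσ, fun x => ?_⟩
  simpa [rewardFrom_zero, integral_coe_X_zero] using h1 x univ MeasurableSet.univ

end MarkovProcess

/-! ### Discretization of stopping times -/

lemma gridCeil_le_iff {h : ℝ≥0} (hh : h ≠ 0) (s i : ℝ≥0) :
    gridCeil h s ≤ i ↔ s ≤ (⌊i / h⌋₊ : ℝ≥0) * h := by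
  have hpos : 0 < h := pos_iff_ne_zero.2 hh
  rw [gridCeil, ← le_div_iff₀ hpos, ← Nat.le_floor_iff zero_le, Nat.ceil_le, div_le_iff₀ hpos]

lemma floor_div_mul_le (h i : ℝ≥0) : (⌊i / h⌋₊ : ℝ≥0) * h ≤ i := by
  rcases eq_or_ne h 0 with rfl | hh
  · simp
  · calc _ ≤ i / h * h := by gcongr; exact Nat.floor_le zero_le
      _ = i := div_mul_cancel₀ i hh

lemma gridCeil_le_mul {h : ℝ≥0} (hh : h ≠ 0) {s : ℝ≥0} {N : ℕ} (hs : s ≤ N * h) :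
    gridCeil h s ≤ N * h := by
  rw [gridCeil_le_iff hh, mul_div_cancel_right₀ _ hh]
  simpa using hs

/-- For a stopping time with finitely many values, this reduces an inequality to the events {τ = s},
where the Markov property at the fixed time s suffices. -/
lemma integral_le_integral_of_fiberwise {Ω β : Type*} [MeasurableSpace Ω] [MeasurableSpace β]
    [MeasurableSingletonClass β] {μ : Measure Ω} {τ : Ω → β} (hτ : Measurable τ)
    (hfin : (range τ).Finite) {Z W : Ω → ℝ} (hZ : Integrable Z μ) (hW : Integrable W μ)
    (h : ∀ s ∈ range τ, ∫ ω in τ ⁻¹' {s}, Z ω ∂μ ≤ ∫ ω in τ ⁻¹' {s}, W ω ∂μ) :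
    ∫ ω, Z ω ∂μ ≤ ∫ ω, W ω ∂μ := by
  have hU : ⋃ s ∈ hfin.toFinset, τ ⁻¹' {s} = univ := by
    ext ω; simp
  have hd : Set.Pairwise (hfin.toFinset : Set β) (Function.onFun Disjoint fun s => τ ⁻¹' {s}) :=
    fun s _ t _ hst => Disjoint.preimage _ (by simpa using hst)
  have key : ∀ {Z : Ω → ℝ}, Integrable Z μ →
      ∫ ω, Z ω ∂μ = ∑ s ∈ hfin.toFinset, ∫ ω in τ ⁻¹' {s}, Z ω ∂μ := fun {Z} hZ => by
    rw [← integral_biUnion_finset _ (fun s _ => hτ (measurableSet_singleton s)) hd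
      (fun s _ => hZ.integrableOn), hU, setIntegral_univ]
  rw [key hZ, key hW]
  exact Finset.sum_le_sum fun s hs => h s (by simpa using hs)

namespace MarkovProcess

variable {E Ω : Type*} [MetricSpace E] [MeasurableSpace E] [BorelSpace E]
  [mΩ : MeasurableSpace Ω] {M : MarkovProcess E Ω}

lemma gridCeil_mem_stoppingTimes {h : ℝ≥0} (hh : h ≠ 0) {N : ℕ} {τ : Ω → ℝ≥0}
    (hτ : τ ∈ M.stoppingTimes (N * h)) :
    (fun ω => gridCeil h (τ ω)) ∈ M.stoppingTimes (N * h) := by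
  refine mem_stoppingTimes (fun i => ?_) fun ω => gridCeil_le_mul hh (hτ.2 ω)
  simp only [gridCeil_le_iff hh]
  exact M.filtration.mono (floor_div_mul_le h i) _ (measurableSet_le_of_mem hτ _)

lemma finite_range_gridCeil {h : ℝ≥0} (hh : h ≠ 0) {N : ℕ} {τ : Ω → ℝ≥0}
    (hτ : τ ∈ M.stoppingTimes (N * h)) : (range fun ω => gridCeil h (τ ω)).Finite := by
  refine ((finite_Iic N).image fun k : ℕ => (k : ℝ≥0) * h).subset ?_
  rintro _ ⟨ω, rfl⟩
  refine ⟨⌈τ ω / h⌉₊, ?_, rfl⟩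
  rw [mem_Iic, Nat.ceil_le, div_le_iff₀ (pos_iff_ne_zero.2 hh)]
  exact hτ.2 ω

lemma measurableSet_fiber {t : ℝ≥0} {τ : Ω → ℝ≥0} (hτ : τ ∈ M.stoppingTimes t)
    (hfin : (range τ).Finite) (s : ℝ≥0) : MeasurableSet[M.filtration s] (τ ⁻¹' {s}) := by
  have hc : (range fun ω => (τ ω : WithTop ℝ≥0)).Countable := by
    have := (hfin.image fun s : ℝ≥0 => (s : WithTop ℝ≥0)).countable
    rwa [← range_comp] at this
  have h : MeasurableSet[M.filtration s] {ω | τ ω = s} := by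
    simpa only [WithTop.coe_inj] using hτ.1.measurableSet_eq_of_countable_range hc s
  exact h

/-- Round up to multiples of t/(n+1). The horizon t is itself a grid point, so rounding never
exceeds it. -/
lemma exists_finite_approx {t : ℝ≥0} {τ : Ω → ℝ≥0} (hτ : τ ∈ M.stoppingTimes t) :
    ∃ σ : ℕ → Ω → ℝ≥0, (∀ n, σ n ∈ M.stoppingTimes t ∧ (range (σ n)).Finite) ∧
      ∀ ω, Tendsto (fun n => σ n ω) atTop (𝓝[≥] τ ω) := by
  rcases eq_or_ne t 0 with rfl | ht
  · have h0 : τ = fun _ => 0 := by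
      ext ω; simpa using hτ.2 ω
    refine ⟨fun _ => τ, fun _ => ⟨hτ, ?_⟩, fun ω => tendsto_const_nhdsWithin (mem_Ici.2 le_rfl)⟩
    rw [h0]
    exact (finite_singleton (0 : ℝ≥0)).subset (range_subset_iff.2 fun _ => rfl)
  · let h : ℕ → ℝ≥0 := fun n => t * (1 / ((n : ℝ≥0) + 1))
    have h0 : ∀ n, h n ≠ 0 := fun n => mul_ne_zero ht (by positivity)
    have hN : ∀ n, ((n + 1 : ℕ) : ℝ≥0) * h n = t := fun n => by
      have : ((n : ℝ≥0) + 1) ≠ 0 := by positivity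
      simp only [h]
      push_cast
      field_simp
    have hl : Tendsto h atTop (𝓝 0) := by
      simpa [h] using tendsto_one_div_succ_nnreal.const_mul t
    have hτn : ∀ n, τ ∈ M.stoppingTimes ((n + 1 : ℕ) * h n) := fun n => by rwa [hN]
    refine ⟨fun n ω => gridCeil (h n) (τ ω), fun n => ⟨?_, finite_range_gridCeil (h0 n) (hτn n)⟩,
      fun ω => tendsto_gridCeil h0 hl (τ ω)⟩
    have := gridCeil_mem_stoppingTimes (h0 n) (hτn n)
    rwa [hN] at this

lemma tendsto_integral_terminal {g : E → ℝ} {D : ℝ} (hg : Continuous g) (hD : ∀ x, |g x| ≤ D)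
    {τ : Ω → ℝ≥0} {σ : ℕ → Ω → ℝ≥0} (hσ : ∀ n, Measurable (σ n))
    (hl : ∀ ω, Tendsto (fun n => σ n ω) atTop (𝓝[≥] τ ω)) (x : E) :
    Tendsto (fun n => ∫ ω, g (M.X (σ n ω) ω) ∂M.P x) atTop (𝓝 (∫ ω, g (M.X (τ ω) ω) ∂M.P x)) :=
  tendsto_integral_of_dominated_convergence (fun _ => D)
    (fun n => (measurable_terminal hg (hσ n)).aestronglyMeasurable) (integrable_const _)
    (fun _ => Eventually.of_forall fun _ => hD _)
    (Eventually.of_forall fun ω => (M.rightCont_comp hg ω (τ ω)).tendsto.comp (hl ω))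

lemma tendsto_integral_reward {f g : E → ℝ} {C D : ℝ} (hf : Continuous f) (hC : ∀ x, |f x| ≤ C)
    (hg : Continuous g) (hD : ∀ x, |g x| ≤ D) {t : ℝ≥0} {τ : Ω → ℝ≥0} {σ : ℕ → Ω → ℝ≥0}
    (hτ : τ ∈ M.stoppingTimes t) (hσ : ∀ n, σ n ∈ M.stoppingTimes t)
    (hl : ∀ ω, Tendsto (fun n => σ n ω) atTop (𝓝[≥] τ ω)) (x : E) :
    Tendsto (fun n => ∫ ω, M.reward f g (σ n) ω ∂M.P x) atTop
      (𝓝 (∫ ω, M.reward f g τ ω ∂M.P x)) := by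
  have hσm := fun n => measurable_of_mem_stoppingTimes (hσ n)
  rw [integral_reward hf hC hτ
    (integrable_terminal_of_bound hg hD (measurable_of_mem_stoppingTimes hτ) x)]
  simp only [fun n => integral_reward hf hC (hσ n) (integrable_terminal_of_bound hg hD (hσm n) x)]
  refine Tendsto.add ?_ (tendsto_integral_terminal hg hD hσm hl x)
  refine tendsto_integral_of_dominated_convergence (fun _ => C * t)
    (fun n => (integrable_running hf hC (hσ n) x).aestronglyMeasurable) (integrable_const _)
    (fun n => Eventually.of_forall fun ω => ?_) (Eventually.of_forall fun ω => ?_)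
  · refine (abs_integral_running_le hC ω _ _).trans ?_
    have h0 : 0 ≤ C := (abs_nonneg _).trans (hC x)
    have : (σ n ω : ℝ) ≤ t := (hσ n).2 ω
    simp only [sub_zero, NNReal.abs_eq]
    gcongr
  · have hc := intervalIntegral.continuous_primitive
      (fun a b => intervalIntegrable_running (M := M) hf hC ω a b) 0
    exact ((hc.comp NNReal.continuous_coe).tendsto (τ ω)).comp
      ((hl ω).mono_right nhdsWithin_le_nhds)

/-! ### Continuity of the value for functions on the one-point compactification -/

variable [MeasurableSpace (OnePoint E)] [BorelSpace (OnePoint E)]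

lemma setIntegral_sq_increment (hM : M.WeakFeller) (G : C(OnePoint E, ℝ)) (x : E) (s r : ℝ≥0)
    {A : Set Ω} (hA : MeasurableSet[M.filtration s] A) :
    ∫ ω in A, (G (M.X s ω) - G (M.X (s + r) ω)) ^ 2 ∂M.P x =
      ∫ ω in A, (fellerSemigroup hM).squareIncrement G r (M.X s ω) ∂M.P x := by
  have h1 := setIntegral_Q hM (G * G) x s r hA
  have h2 : ∫ ω in A, G (M.X s ω) * G (M.X (s + r) ω) ∂M.P x =
      ∫ ω in A, (G * (fellerSemigroup hM).Q r G) (M.X s ω) ∂M.P x :=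
    M.setIntegral_mul_markov (continuous_coe G) (abs_coe_le G) (continuous_coe G) (abs_coe_le G)
      x s r hA
  have hi : ∀ (φ : C(OnePoint E, ℝ)) u, Integrable (fun ω => φ (M.X u ω)) ((M.P x).restrict A) :=
    fun φ u => (integrable_coe φ u x).integrableOn
  have hi2 : Integrable (fun ω => G (M.X s ω) * G (M.X (s + r) ω)) ((M.P x).restrict A) :=
    (hi G (s + r)).bdd_mul (c := ‖G‖) (hi G s).aestronglyMeasurable
      (Eventually.of_forall fun _ => abs_coe_le G _)
  have hlin : ∀ {a b c : Ω → ℝ}, Integrable a ((M.P x).restrict A) →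
      Integrable b ((M.P x).restrict A) → Integrable c ((M.P x).restrict A) →
      ∫ ω in A, (a ω - 2 * b ω + c ω) ∂M.P x =
        ∫ ω in A, a ω ∂M.P x - 2 * ∫ ω in A, b ω ∂M.P x + ∫ ω in A, c ω ∂M.P x := by
    intro a b c ha hb hc
    have h3 : Integrable (fun ω => a ω - 2 * b ω) ((M.P x).restrict A) := ha.sub (hb.const_mul 2)
    rw [integral_add h3 hc, integral_sub ha (hb.const_mul 2), integral_const_mul]
  calc ∫ ω in A, (G (M.X s ω) - G (M.X (s + r) ω)) ^ 2 ∂M.P x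
      = ∫ ω in A, (((G * G) (M.X (s + r) ω) - 2 * (G (M.X s ω) * G (M.X (s + r) ω))) +
          (G * G) (M.X s ω)) ∂M.P x := by
        refine integral_congr_ae (Eventually.of_forall fun ω => ?_)
        simp only [ContinuousMap.mul_apply]
        ring
    _ = ∫ ω in A, (((fellerSemigroup hM).Q r (G * G) (M.X s ω) -
          2 * (G * (fellerSemigroup hM).Q r G) (M.X s ω)) + (G * G) (M.X s ω)) ∂M.P x := by
        rw [hlin (hi _ _) hi2 (hi _ _), hlin (hi _ _) (hi _ _) (hi _ _), h1, h2]
    _ = _ := rfl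

/-- On {τ = s} the lag r = c(s) - s ≤ η is deterministic, so the conditional second moment is at
most ε²; the first moment follows from |a| ≤ a²/(2ε) + ε/2. -/
lemma integral_abs_increment_le (hM : M.WeakFeller) (G : C(OnePoint E, ℝ)) {ε : ℝ} (hε : 0 < ε)
    {η : ℝ≥0} (hη : ∀ r ≤ η, ‖(fellerSemigroup hM).squareIncrement G r‖ ≤ ε ^ 2) {t : ℝ≥0}
    {τ : Ω → ℝ≥0} (hτ : τ ∈ M.stoppingTimes t) (hfin : (range τ).Finite) {c : ℝ≥0 → ℝ≥0}
    (hc : Measurable c) (hc1 : ∀ s, s ≤ c s) (hc2 : ∀ s, c s ≤ s + η) (x : E) :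
    ∫ ω, |G (M.X (τ ω) ω) - G (M.X (c (τ ω)) ω)| ∂M.P x ≤ ε := by
  have hτm := measurable_of_mem_stoppingTimes hτ
  have hi1 := integrable_terminal_of_bound (M := M) (continuous_coe G) (abs_coe_le G) hτm x
  have hi2 := integrable_terminal_of_bound (M := M) (continuous_coe G) (abs_coe_le G)
    (hc.comp hτm) x
  have hi : Integrable (fun ω => (G (M.X (τ ω) ω) - G (M.X (c (τ ω)) ω)) ^ 2) (M.P x) := by
    refine Integrable.of_bound ((hi1.sub hi2).aestronglyMeasurable.pow 2) ((‖G‖ + ‖G‖) ^ 2)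
      (Eventually.of_forall fun ω => ?_)
    rw [norm_pow]
    gcongr
    exact (norm_sub_le _ _).trans (add_le_add (abs_coe_le G _) (abs_coe_le G _))
  have hsq : ∫ ω, (G (M.X (τ ω) ω) - G (M.X (c (τ ω)) ω)) ^ 2 ∂M.P x ≤ ∫ _, ε ^ 2 ∂M.P x := by
    refine integral_le_integral_of_fiberwise hτm hfin hi (integrable_const _) fun s _ => ?_
    have hA := measurableSet_fiber hτ hfin s
    obtain ⟨r, hr⟩ := exists_add_of_le (hc1 s)
    have hrη : r ≤ η := by
      have := hc2 s
      rw [hr] at this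
      exact le_of_add_le_add_left this
    calc ∫ ω in τ ⁻¹' {s}, (G (M.X (τ ω) ω) - G (M.X (c (τ ω)) ω)) ^ 2 ∂M.P x
        = ∫ ω in τ ⁻¹' {s}, (G (M.X s ω) - G (M.X (s + r) ω)) ^ 2 ∂M.P x := by
          refine setIntegral_congr_fun (M.filtration.le _ _ hA) fun ω (hω : τ ω = s) => ?_
          simp only [hω, hr]
      _ = ∫ ω in τ ⁻¹' {s}, (fellerSemigroup hM).squareIncrement G r (M.X s ω) ∂M.P x :=
          setIntegral_sq_increment hM G x s r hA
      _ ≤ _ := setIntegral_mono (integrable_coe _ s x).integrableOn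
          (integrable_const _).integrableOn
          fun ω => (le_abs_self _).trans ((abs_coe_le _ _).trans (hη r hrη))
  calc ∫ ω, |G (M.X (τ ω) ω) - G (M.X (c (τ ω)) ω)| ∂M.P x
      ≤ ∫ ω, ((2 * ε)⁻¹ * (G (M.X (τ ω) ω) - G (M.X (c (τ ω)) ω)) ^ 2 + ε / 2) ∂M.P x := by
        refine integral_mono (hi1.sub hi2).abs ((hi.const_mul _).add (integrable_const _))
          fun ω => ?_
        set a := G (M.X (τ ω) ω) - G (M.X (c (τ ω)) ω)
        have h1 : (2 * ε)⁻¹ * a ^ 2 + ε / 2 - |a| = (2 * ε)⁻¹ * (|a| - ε) ^ 2 := by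
          rw [← sq_abs a]
          field_simp
          ring
        have h2 : 0 ≤ (2 * ε)⁻¹ * (|a| - ε) ^ 2 := by positivity
        simp only
        linarith
    _ = (2 * ε)⁻¹ * ∫ ω, (G (M.X (τ ω) ω) - G (M.X (c (τ ω)) ω)) ^ 2 ∂M.P x + ε / 2 := by
        rw [integral_add (hi.const_mul _) (integrable_const _), integral_const_mul]
        simp
    _ ≤ (2 * ε)⁻¹ * ε ^ 2 + ε / 2 := by
        gcongr
        simpa using hsq
    _ = ε := by field_simp; ring

variable [FirstCountableTopology (OnePoint E)] [LocallyCompactSpace E]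

/-- Rounding up to the h-grid costs at most ‖F‖h in the running reward and ε in the terminal one.
The latter estimate needs finitely many values, so τ is first replaced by its finite approximations,
on a different grid. -/
lemma integral_reward_le_dpValue_add (hM : M.WeakFeller) (F G : C(OnePoint E, ℝ)) {ε : ℝ}
    (hε : 0 < ε) {h : ℝ≥0} (hη : ∀ r ≤ h, ‖(fellerSemigroup hM).squareIncrement G r‖ ≤ ε ^ 2)
    (N : ℕ) {τ : Ω → ℝ≥0} (hτ : τ ∈ M.stoppingTimes (N * h)) (x : E) :
    ∫ ω, M.reward (fun y => F y) (fun y => G y) τ ω ∂M.P x ≤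
      (fellerSemigroup hM).dpValue F G h N x + (‖F‖ * h + ε) := by
  have herr : 0 ≤ ‖F‖ * h + ε := by positivity
  rcases eq_or_ne h 0 with rfl | hh
  · have := integral_reward_le_dpValue hM F G x 0 N hτ fun ω => ⟨0, by simpa using hτ.2 ω⟩
    linarith
  obtain ⟨σ, hσ, hl⟩ := exists_finite_approx hτ
  refine le_of_tendsto (tendsto_integral_reward (continuous_coe F) (abs_coe_le F)
    (continuous_coe G) (abs_coe_le G) hτ (fun n => (hσ n).1) hl x) (Eventually.of_forall fun n => ?_)
  obtain ⟨hσn, hfin⟩ := hσ n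
  have hρ := gridCeil_mem_stoppingTimes hh hσn
  have h1 := integral_reward_le_dpValue hM F G x h N hρ fun ω => ⟨_, rfl⟩
  have h2 := integral_abs_increment_le hM G hε hη hσn hfin (measurable_gridCeil h)
    (le_gridCeil hh) (gridCeil_le_add h) x
  have hσm := measurable_of_mem_stoppingTimes hσn
  have hρm := measurable_of_mem_stoppingTimes hρ
  have hi1 := integrable_terminal_of_bound (M := M) (continuous_coe G) (abs_coe_le G) hσm x
  have hi2 := integrable_terminal_of_bound (M := M) (continuous_coe G) (abs_coe_le G) hρm x
  have hr1 := integrable_reward (g := fun y : E => G y) (continuous_coe F) (abs_coe_le F) hσn hi1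
  have hr2 := integrable_reward (g := fun y : E => G y) (continuous_coe F) (abs_coe_le F) hρ hi2
  have h3 : ∫ ω, M.reward (fun y => F y) (fun y => G y) (σ n) ω ∂M.P x ≤
      ∫ ω, (M.reward (fun y => F y) (fun y => G y) (fun ω => gridCeil h (σ n ω)) ω + (‖F‖ * h +
        |G (M.X (σ n ω) ω) - G (M.X (gridCeil h (σ n ω)) ω)|)) ∂M.P x := by
    refine integral_mono hr1 (hr2.add ((integrable_const _).add (hi1.sub hi2).abs)) fun ω => ?_
    have h4 := intervalIntegral.integral_add_adjacent_intervals
      (intervalIntegrable_running (M := M) (continuous_coe F) (abs_coe_le F) ω 0 (σ n ω))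
      (intervalIntegrable_running (M := M) (continuous_coe F) (abs_coe_le F) ω (σ n ω)
        (gridCeil h (σ n ω)))
    have h5 : |∫ s in (σ n ω : ℝ)..(gridCeil h (σ n ω) : ℝ), F (M.X s.toNNReal ω)| ≤ ‖F‖ * h := by
      refine (abs_integral_running_le (f := fun y : E => F y) (abs_coe_le F) ω _ _).trans ?_
      have h6 : (σ n ω : ℝ) ≤ gridCeil h (σ n ω) := le_gridCeil hh _
      have h7 : (gridCeil h (σ n ω) : ℝ) ≤ σ n ω + h := gridCeil_le_add h _
      gcongr
      rw [abs_of_nonneg (by linarith)]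
      linarith
    have h8 := (abs_le.1 h5).1
    have h9 := le_abs_self (G (M.X (σ n ω) ω) - G (M.X (gridCeil h (σ n ω)) ω))
    simp only [reward]
    linarith
  have hi3 : Integrable (fun ω => |G (M.X (σ n ω) ω) - G (M.X (gridCeil h (σ n ω)) ω)|) (M.P x) :=
    (hi1.sub hi2).abs
  have hi4 : Integrable (fun ω => ‖F‖ * h + |G (M.X (σ n ω) ω) - G (M.X (gridCeil h (σ n ω)) ω)|)
    (M.P x) := (integrable_const _).add hi3
  rw [integral_add hr2 hi4, integral_add (integrable_const _) hi3] at h3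
  simp only [integral_const, probReal_univ, one_smul] at h3
  linarith

lemma abs_value_sub_dpValue_le (hM : M.WeakFeller) (F G : C(OnePoint E, ℝ)) {ε : ℝ}
    (hε : 0 < ε) {h : ℝ≥0} (hη : ∀ r ≤ h, ‖(fellerSemigroup hM).squareIncrement G r‖ ≤ ε ^ 2)
    (N : ℕ) (x : E) :
    |M.value (fun y => F y) (fun y => G y) (N * h) x - (fellerSemigroup hM).dpValue F G h N x| ≤
      ‖F‖ * h + ε := by
  have hbdd := bddAbove_expectedRewards_of_bound (M := M) (continuous_coe F) (abs_coe_le F)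
    (continuous_coe G) (abs_coe_le G) (N * h) x
  obtain ⟨σ, hσ, hσeq⟩ := exists_integral_reward_eq_dpValue hM F G h N
  have h1 : (fellerSemigroup hM).dpValue F G h N x ≤
      M.value (fun y => F y) (fun y => G y) (N * h) x := by
    rw [← hσeq x]
    exact le_csSup hbdd ⟨σ, hσ, rfl⟩
  have h2 : M.value (fun y => F y) (fun y => G y) (N * h) x ≤
      (fellerSemigroup hM).dpValue F G h N x + (‖F‖ * h + ε) := by
    refine csSup_le ((stoppingTimes_nonempty _).image _) ?_
    rintro _ ⟨τ, hτ, rfl⟩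
    exact integral_reward_le_dpValue_add hM F G hε hη N hτ x
  rw [abs_of_nonneg (by linarith)]
  linarith

lemma continuousOn_value_coe (hM : M.WeakFeller) (F G : C(OnePoint E, ℝ)) (T : ℝ≥0) :
    ContinuousOn (fun p : ℝ≥0 × E => M.value (fun y => F y) (fun y => G y) p.1 p.2)
      (Icc 0 T ×ˢ univ) := by
  -- n + 1 steps of length t/(n+1) end exactly at t; the step varies with t, which is why continuity
  -- of `dpValue` in h matters.
  let V : ℕ → ℝ≥0 × E → ℝ := fun n p =>
    (fellerSemigroup hM).dpValue F G (p.1 * (1 / ((n : ℝ≥0) + 1))) (n + 1) p.2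
  have hV : ∀ n, Continuous (V n) := fun n =>
    (((fellerSemigroup hM).continuous_dpValue F G (n + 1)).comp
      (continuous_fst.mul continuous_const)).eval (OnePoint.continuous_coe.comp continuous_snd)
  have hlim : TendstoUniformlyOn V
      (fun p : ℝ≥0 × E => M.value (fun y => F y) (fun y => G y) p.1 p.2) atTop
      (Icc 0 T ×ˢ univ) := by
    rw [Metric.tendstoUniformlyOn_iff]
    intro ε hε
    obtain ⟨η, hη0, hη⟩ := (fellerSemigroup hM).exists_norm_squareIncrement_le G
      (show (0 : ℝ) < (ε / 3) ^ 2 by positivity)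
    have hl : Tendsto (fun n : ℕ => T * (1 / ((n : ℝ≥0) + 1))) atTop (𝓝 0) := by
      simpa using tendsto_one_div_succ_nnreal.const_mul T
    have hl2 : Tendsto (fun n : ℕ => ‖F‖ * ((T * (1 / ((n : ℝ≥0) + 1)) : ℝ≥0) : ℝ)) atTop
        (𝓝 0) := by
      have h1 := ((NNReal.continuous_coe.tendsto 0).comp hl).const_mul ‖F‖
      rw [NNReal.coe_zero, mul_zero] at h1
      exact h1
    filter_upwards [hl.eventually (gt_mem_nhds hη0),
      hl2.eventually (gt_mem_nhds (show 0 < ε / 3 by positivity))] with n hn1 hn2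
    rintro ⟨t, x⟩ ⟨ht, -⟩
    have htT : t ≤ T := ht.2
    set h : ℝ≥0 := t * (1 / ((n : ℝ≥0) + 1)) with hdef
    have hhT : h ≤ T * (1 / ((n : ℝ≥0) + 1)) := mul_le_mul_of_nonneg_right htT zero_le
    have hN : ((n + 1 : ℕ) : ℝ≥0) * h = t := by
      have : ((n : ℝ≥0) + 1) ≠ 0 := by positivity
      rw [hdef]
      push_cast
      field_simp
    have key := abs_value_sub_dpValue_le hM F G (show 0 < ε / 3 by positivity)
      (fun r hr => hη r (hr.trans (hhT.trans hn1.le))) (n + 1) x (h := h)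
    rw [hN] at key
    have h3 : ‖F‖ * (h : ℝ) ≤ ‖F‖ * ((T * (1 / ((n : ℝ≥0) + 1)) : ℝ≥0) : ℝ) := by
      gcongr
    rw [Real.dist_eq]
    refine lt_of_le_of_lt key ?_
    linarith
  exact hlim.continuousOn (Frequently.of_forall fun n => (hV n).continuousOn)

/-! ### Compact containment and bounded rewards -/

/-- Tightness of the single law of X_T: Urysohn functions equal to 1 on an exhaustion by compacts
converge pointwise to 1 on E. -/
lemma exists_integral_gt [SigmaCompactSpace E] (T : ℝ≥0) (x : E) {ε : ℝ} (hε : 0 < ε) :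
    ∃ u : C(OnePoint E, ℝ), (∀ y, u y ∈ Icc (0 : ℝ) 1) ∧ u OnePoint.infty = 0 ∧
      1 - ε < ∫ ω, u (M.X T ω) ∂M.P x := by
  let K : CompactExhaustion E := default
  have hex : ∀ n, ∃ u : C(OnePoint E, ℝ), (∀ y, u y ∈ Icc (0 : ℝ) 1) ∧ u OnePoint.infty = 0 ∧
      ∀ y ∈ K n, u y = 1 := fun n => by
    obtain ⟨u, h0, h1, h01⟩ := exists_continuous_zero_one_of_isClosed (X := OnePoint E)
      (s := {OnePoint.infty}) (t := (↑) '' K n) isClosed_singleton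
      (((K.isCompact n).image OnePoint.continuous_coe).isClosed)
      (disjoint_singleton_left.2 OnePoint.infty_notMem_image_coe)
    exact ⟨u, h01, h0 rfl, fun y hy => h1 ⟨y, hy, rfl⟩⟩
  choose u h01 h0 h1 using hex
  have hl : Tendsto (fun n => ∫ ω, u n (M.X T ω) ∂M.P x) atTop (𝓝 (∫ _, (1 : ℝ) ∂M.P x)) := by
    refine tendsto_integral_of_dominated_convergence (fun _ => 1)
      (fun n => (integrable_coe _ _ _).aestronglyMeasurable) (integrable_const _)
      (fun n => Eventually.of_forall fun ω => ?_) (Eventually.of_forall fun ω => ?_)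
    · rw [Real.norm_eq_abs, abs_of_nonneg (h01 n _).1]
      exact (h01 n _).2
    · obtain ⟨n, hn⟩ := K.exists_mem (M.X T ω)
      refine tendsto_const_nhds.congr' ?_
      filter_upwards [eventually_ge_atTop n] with m hm
      exact (h1 m _ (K.subset hm hn)).symm
  simp only [integral_const, probReal_univ, one_smul] at hl
  obtain ⟨n, hn⟩ := (hl.eventually (lt_mem_nhds (show 1 - ε < 1 by linarith))).exists
  exact ⟨u n, h01 n, h0 n, hn⟩

/-- A path far out at time τ probably stays far out until T, because infinity is absorbing for the
extended semigroup. Hence tightness at time T, stable for x near x₀ since Q_T u is continuous,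
controls the process at every τ ≤ T. -/
lemma exists_cutoff [SigmaCompactSpace E] (hM : M.WeakFeller) (T : ℝ≥0) (x₀ : E) {ε : ℝ}
    (hε : 0 < ε) :
    ∃ χ : C(OnePoint E, ℝ), (∀ y, χ y ∈ Icc (0 : ℝ) 1) ∧ χ OnePoint.infty = 0 ∧
      ∀ᶠ x in 𝓝 x₀, ∀ τ ∈ M.stoppingTimes T, ∫ ω, (1 - χ (M.X (τ ω) ω)) ∂M.P x ≤ ε := by
  set S := fellerSemigroup hM with hS
  obtain ⟨u, hu01, hu0, hu⟩ := exists_integral_gt (M := M) T x₀ (half_pos hε)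
  -- Points from which Q_s u ≥ 1/2 for some s ≤ T: a projection of a compact set, missing infinity
  -- because Q_s u(∞) = u(∞) = 0.
  let L : Set (OnePoint E) := Prod.snd '' ((Icc (0 : ℝ≥0) T ×ˢ (univ : Set (OnePoint E))) ∩
    {p | 1 / 2 ≤ S.Q p.1 u p.2})
  have hQc : Continuous fun p : ℝ≥0 × OnePoint E => S.Q p.1 u p.2 :=
    ((S.continuous_Q u).comp continuous_fst).eval continuous_snd
  have hLc : IsCompact L :=
    ((isCompact_Icc.prod isCompact_univ).inter_right (isClosed_le continuous_const hQc)).image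
      continuous_snd
  have hL : OnePoint.infty ∉ L := by
    rintro ⟨⟨s, y⟩, ⟨-, hs⟩, rfl⟩
    have h1 : S.Q s u OnePoint.infty = 0 := hu0
    have h2 : (1 / 2 : ℝ) ≤ S.Q s u OnePoint.infty := hs
    rw [h1] at h2
    norm_num at h2
  obtain ⟨χ, hχ0, hχ1, hχ01⟩ := exists_continuous_zero_one_of_isClosed (X := OnePoint E)
    (s := {OnePoint.infty}) (t := L) isClosed_singleton hLc.isClosed (disjoint_singleton_left.2 hL)
  have hu1 : u ≤ ContinuousMap.const _ 1 := ContinuousMap.le_def.2 fun y => (hu01 y).2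
  -- On L the left side vanishes; off L the right side exceeds 1. The factor 2 is why u was chosen
  -- with ε/2.
  have hpt : ∀ s ≤ T, ∀ y : OnePoint E, 1 - χ y ≤ 2 * (1 - S.Q s u y) := by
    intro s hs y
    by_cases hy : y ∈ L
    · have h1 : S.Q s u y ≤ 1 := by
        have := ContinuousMap.le_def.1 (S.mono s hu1) y
        rwa [S.map_const] at this
      have h2 : χ y = 1 := hχ1 hy
      rw [h2]
      linarith
    · have h1 : S.Q s u y < 1 / 2 := by
        by_contra! hcon
        exact hy ⟨(s, y), ⟨⟨⟨zero_le, hs⟩, trivial⟩, hcon⟩, rfl⟩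
      linarith [(hχ01 y).1]
  let ψ : C(OnePoint E, ℝ) := 1 - χ
  have hψ : ∀ y, ψ y = 1 - χ y := fun _ => rfl
  have hfin : ∀ x, ∀ τ ∈ M.stoppingTimes T, (range τ).Finite →
      ∫ ω, ψ (M.X (τ ω) ω) ∂M.P x ≤ 2 * (1 - S.Q T u x) := by
    intro x τ hτ hf
    have hτm := measurable_of_mem_stoppingTimes hτ
    have hiu : Integrable (fun ω => 2 * (1 - u (M.X T ω))) (M.P x) :=
      ((integrable_const _).sub (integrable_coe u T x)).const_mul 2
    have hle : ∫ ω, ψ (M.X (τ ω) ω) ∂M.P x ≤ ∫ ω, 2 * (1 - u (M.X T ω)) ∂M.P x := by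
      refine integral_le_integral_of_fiberwise hτm hf
        (integrable_terminal_of_bound (continuous_coe ψ) (abs_coe_le ψ) hτm x) hiu ?_
      rintro s ⟨ω₀, rfl⟩
      set s := τ ω₀
      have hA := measurableSet_fiber hτ hf s
      obtain ⟨r, hr⟩ := exists_add_of_le (hτ.2 ω₀)
      have hr : T = s + r := hr
      have hrT : r ≤ T := by rw [hr]; exact le_add_self
      calc ∫ ω in τ ⁻¹' {s}, ψ (M.X (τ ω) ω) ∂M.P x
          = ∫ ω in τ ⁻¹' {s}, ψ (M.X s ω) ∂M.P x :=
            setIntegral_congr_fun (M.filtration.le _ _ hA) fun ω (hω : τ ω = s) => by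
              simp only [hω]
        _ ≤ ∫ ω in τ ⁻¹' {s}, 2 * (1 - S.Q r u (M.X s ω)) ∂M.P x :=
            setIntegral_mono (integrable_coe _ _ x).integrableOn
              (((integrable_const _).sub (integrable_coe _ s x)).const_mul 2).integrableOn
              fun ω => hpt r hrT _
        _ = ∫ ω in τ ⁻¹' {s}, 2 * (1 - u (M.X T ω)) ∂M.P x := by
            rw [integral_const_mul, integral_const_mul,
              integral_sub (integrable_const _) (integrable_coe _ s x).integrableOn,
              integral_sub (integrable_const _) (integrable_coe _ T x).integrableOn, hr,
              setIntegral_Q hM u x s r hA]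
    refine hle.trans_eq ?_
    rw [integral_const_mul, integral_sub (integrable_const _) (integrable_coe _ T x)]
    simp only [integral_const, probReal_univ, one_smul]
    rfl
  refine ⟨χ, hχ01, hχ0 rfl, ?_⟩
  have hev : ∀ᶠ x : E in 𝓝 x₀, 1 - ε / 2 < S.Q T u x :=
    (continuous_coe (S.Q T u)).continuousAt.eventually (lt_mem_nhds hu)
  filter_upwards [hev] with x hx τ hτ
  obtain ⟨σ, hσ, hl⟩ := exists_finite_approx hτ
  refine le_of_tendsto (tendsto_integral_terminal (continuous_coe ψ) (abs_coe_le ψ)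
    (fun n => measurable_of_mem_stoppingTimes (hσ n).1) hl x) (Eventually.of_forall fun n => ?_)
  have := hfin x (σ n) (hσ n).1 (hσ n).2
  linarith

lemma exists_extension_mul {f : E → ℝ} {C : ℝ} (hf : Continuous f) (hC : ∀ x, |f x| ≤ C)
    {χ : C(OnePoint E, ℝ)} (hχ : χ OnePoint.infty = 0) :
    ∃ F : C(OnePoint E, ℝ), ∀ x : E, F x = f x * χ x := by
  refine ⟨⟨fun y => y.elim 0 fun x => f x * χ x, ?_⟩, fun x => rfl⟩
  rw [OnePoint.continuous_iff]
  simp only [OnePoint.elim_some, OnePoint.elim_infty]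
  refine ⟨?_, hf.mul (continuous_coe χ)⟩
  have h1 : Tendsto (fun x : E => χ x) (coclosedCompact E) (𝓝 0) := by
    have := (χ.continuous.tendsto OnePoint.infty).comp OnePoint.tendsto_coe_infty
    rwa [hχ] at this
  have h2 : Tendsto (fun x : E => C * |χ x|) (coclosedCompact E) (𝓝 0) := by
    simpa using h1.abs.const_mul C
  refine squeeze_zero_norm (fun x => ?_) h2
  rw [norm_mul]
  exact mul_le_mul_of_nonneg_right (hC x) (norm_nonneg _)

/-- Both errors are bounded by multiples of 1 - χ. For the running part, extend the time integral to
[0, T] and use the hypothesis at deterministic times through Fubini. -/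
lemma abs_integral_reward_sub_le {f g : E → ℝ} {C D : ℝ} (hf : Continuous f)
    (hC : ∀ x, |f x| ≤ C) (hg : Continuous g) (hD : ∀ x, |g x| ≤ D) {χ F G : C(OnePoint E, ℝ)}
    (hχ : ∀ y, χ y ∈ Icc (0 : ℝ) 1) (hF : ∀ x : E, F x = f x * χ x)
    (hG : ∀ x : E, G x = g x * χ x) {t T : ℝ≥0} (htT : t ≤ T) {x : E} {ε : ℝ}
    (h : ∀ τ ∈ M.stoppingTimes T, ∫ ω, (1 - χ (M.X (τ ω) ω)) ∂M.P x ≤ ε) {τ : Ω → ℝ≥0}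
    (hτ : τ ∈ M.stoppingTimes t) :
    |∫ ω, M.reward f g τ ω ∂M.P x - ∫ ω, M.reward (fun y => F y) (fun y => G y) τ ω ∂M.P x| ≤
      (C * T + D) * ε := by
  have hC0 : 0 ≤ C := (abs_nonneg _).trans (hC x)
  have hD0 : 0 ≤ D := (abs_nonneg _).trans (hD x)
  have hτT := stoppingTimes_mono htT hτ
  have hτm := measurable_of_mem_stoppingTimes hτ
  let ψ : C(OnePoint E, ℝ) := 1 - χ
  have hψ : ∀ y, ψ y = 1 - χ y := fun _ => rfl
  have hψ0 : ∀ y, 0 ≤ ψ y := fun y => by rw [hψ]; linarith [(hχ y).2]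
  have hdiff : ∀ {φ : E → ℝ} {B : ℝ} {Φ : C(OnePoint E, ℝ)}, (∀ x, |φ x| ≤ B) →
      (∀ x : E, Φ x = φ x * χ x) → ∀ y : E, |φ y - Φ y| ≤ B * ψ y := by
    intro φ B Φ hB hΦ y
    rw [hΦ, show φ y - φ y * χ y = φ y * ψ y by rw [hψ]; ring, abs_mul, abs_of_nonneg (hψ0 y)]
    exact mul_le_mul_of_nonneg_right (hB y) (hψ0 y)
  have hg1 := integrable_terminal_of_bound (M := M) hg hD hτm x
  have hg2 := integrable_terminal_of_bound (M := M) (continuous_coe G) (abs_coe_le G) hτm x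
  have hψi := integrable_terminal_of_bound (M := M) (continuous_coe ψ) (abs_coe_le ψ) hτm x
  have hr1 := integrable_reward hf hC hτ hg1
  have hr2 := integrable_reward (g := fun y : E => G y) (continuous_coe F) (abs_coe_le F) hτ hg2
  have hrun := integrable_running (M := M) (continuous_coe ψ) (abs_coe_le ψ)
    (const_mem_stoppingTimes (le_refl T)) x
  rw [← integral_sub hr1 hr2]
  have hmono : ∀ ω, |M.reward f g τ ω - M.reward (fun y => F y) (fun y => G y) τ ω| ≤
      C * (∫ s in (0 : ℝ)..(T : ℝ), ψ (M.X s.toNNReal ω)) + D * ψ (M.X (τ ω) ω) := by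
    intro ω
    have hi1 := intervalIntegrable_running (M := M) hf hC ω 0 (τ ω)
    have hi2 := intervalIntegrable_running (M := M) (continuous_coe F) (abs_coe_le F) ω 0 (τ ω)
    have hi3 := fun a => intervalIntegrable_running (M := M) (continuous_coe ψ) (abs_coe_le ψ) ω 0 a
    have e1 : M.reward f g τ ω - M.reward (fun y => F y) (fun y => G y) τ ω =
        (∫ s in (0 : ℝ)..(τ ω : ℝ), (f (M.X s.toNNReal ω) - F (M.X s.toNNReal ω))) +
          (g (M.X (τ ω) ω) - G (M.X (τ ω) ω)) := by
      rw [intervalIntegral.integral_sub hi1 hi2, reward, reward]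
      ring
    rw [e1]
    refine (abs_add_le _ _).trans (add_le_add ?_ (hdiff hD hG _))
    have hτ0 : (τ ω : ℝ) ≤ T := hτT.2 ω
    calc |∫ s in (0 : ℝ)..(τ ω : ℝ), (f (M.X s.toNNReal ω) - F (M.X s.toNNReal ω))|
        ≤ ∫ s in (0 : ℝ)..(τ ω : ℝ), C * ψ (M.X s.toNNReal ω) := by
          rw [← Real.norm_eq_abs]
          exact intervalIntegral.norm_integral_le_of_norm_le (τ ω).coe_nonneg
            (Eventually.of_forall fun s _ => hdiff hC hF _) ((hi3 _).const_mul C)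
      _ ≤ ∫ s in (0 : ℝ)..(T : ℝ), C * ψ (M.X s.toNNReal ω) :=
          intervalIntegral.integral_mono_interval le_rfl (τ ω).coe_nonneg hτ0
            (Eventually.of_forall fun s => mul_nonneg hC0 (hψ0 _)) ((hi3 _).const_mul C)
      _ = _ := intervalIntegral.integral_const_mul _ _
  have hswap : ∫ ω, (∫ s in (0 : ℝ)..(T : ℝ), ψ (M.X s.toNNReal ω)) ∂M.P x ≤ T * ε := by
    rw [← intervalIntegral_integral_swap]
    · calc ∫ s in (0 : ℝ)..(T : ℝ), (∫ ω, ψ (M.X s.toNNReal ω) ∂M.P x)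
          ≤ ∫ _ in (0 : ℝ)..(T : ℝ), ε := by
            refine intervalIntegral.integral_mono_on T.coe_nonneg ?_ (by simp) fun s hs => ?_
            · refine (intervalIntegrable_const (c := ‖ψ‖)).mono_fun' ?_ (Eventually.of_forall
                fun s => ?_)
              · have := (measurable_running (M := M) (continuous_coe ψ)).stronglyMeasurable
                exact (this.integral_prod_right' (ν := M.P x)).aestronglyMeasurable
              · exact M.abs_integral_X_le (abs_coe_le ψ) _ x
            · refine h _ (const_mem_stoppingTimes ?_)
              rw [Real.toNNReal_le_iff_le_coe]
              exact hs.2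
        _ = T * ε := by simp
    · rw [uIoc_of_le T.coe_nonneg]
      exact Integrable.of_bound
        (measurable_running (M := M) (continuous_coe ψ)).aestronglyMeasurable ‖ψ‖
        (Eventually.of_forall fun p => abs_coe_le ψ _)
  calc |∫ ω, (M.reward f g τ ω - M.reward (fun y => F y) (fun y => G y) τ ω) ∂M.P x|
      ≤ ∫ ω, |M.reward f g τ ω - M.reward (fun y => F y) (fun y => G y) τ ω| ∂M.P x :=
        abs_integral_le_integral_abs
    _ ≤ ∫ ω, (C * (∫ s in (0 : ℝ)..(T : ℝ), ψ (M.X s.toNNReal ω)) + D * ψ (M.X (τ ω) ω))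
          ∂M.P x :=
        integral_mono (hr1.sub hr2).abs ((hrun.const_mul C).add (hψi.const_mul D)) hmono
    _ = C * ∫ ω, (∫ s in (0 : ℝ)..(T : ℝ), ψ (M.X s.toNNReal ω)) ∂M.P x +
          D * ∫ ω, ψ (M.X (τ ω) ω) ∂M.P x := by
        rw [integral_add (hrun.const_mul C) (hψi.const_mul D), integral_const_mul,
          integral_const_mul]
    _ ≤ C * (T * ε) + D * ε := by
        gcongr
        exact h τ hτT
    _ = (C * T + D) * ε := by ring

lemma continuousOn_value_of_bound [SigmaCompactSpace E] (hM : M.WeakFeller) {f g : E → ℝ}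
    {C D : ℝ} (hf : Continuous f) (hC : ∀ x, |f x| ≤ C) (hg : Continuous g)
    (hD : ∀ x, |g x| ≤ D) (T : ℝ≥0) :
    ContinuousOn (fun p : ℝ≥0 × E => M.value f g p.1 p.2) (Icc 0 T ×ˢ univ) := by
  rintro ⟨t₀, x₀⟩ h₀
  refine continuousWithinAt_of_locally_uniform_approx_of_continuousWithinAt h₀ fun U hU => ?_
  obtain ⟨ε, hε, hεU⟩ := Metric.mem_uniformity_dist.1 hU
  have hC0 : 0 ≤ C := (abs_nonneg _).trans (hC x₀)
  have hD0 : 0 ≤ D := (abs_nonneg _).trans (hD x₀)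
  -- The extra 1 only makes B positive, so that ε/(2B) is a legitimate tolerance.
  set B : ℝ := C * T + D + 1 with hB
  have hB0 : 0 < B := by positivity
  obtain ⟨χ, hχ01, hχ0, hχ⟩ := exists_cutoff hM T x₀ (show 0 < ε / (2 * B) by positivity)
  obtain ⟨F, hF⟩ := exists_extension_mul hf hC hχ0
  obtain ⟨G, hG⟩ := exists_extension_mul hg hD hχ0
  refine ⟨(Icc 0 T ×ˢ univ) ∩ Prod.snd ⁻¹' {x | ∀ τ ∈ M.stoppingTimes T,
      ∫ ω, (1 - χ (M.X (τ ω) ω)) ∂M.P x ≤ ε / (2 * B)},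
    inter_mem self_mem_nhdsWithin (mem_nhdsWithin_of_mem_nhds (continuous_snd.continuousAt hχ)),
    fun p => M.value (fun y => F y) (fun y => G y) p.1 p.2,
    continuousOn_value_coe hM F G T _ h₀, ?_⟩
  rintro ⟨t, x⟩ ⟨⟨ht, -⟩, hx⟩
  refine hεU ?_
  rw [Real.dist_eq]
  have h1 : |M.value f g t x - M.value (fun y => F y) (fun y => G y) t x| ≤
      (C * T + D) * (ε / (2 * B)) :=
    abs_sSup_image_sub_le (stoppingTimes_nonempty t)
      (bddAbove_expectedRewards_of_bound hf hC hg hD t x)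
      fun τ hτ => abs_integral_reward_sub_le hf hC hg hD hχ01 hF hG ht.2 hx hτ
  refine lt_of_le_of_lt h1 ?_
  calc (C * T + D) * (ε / (2 * B)) ≤ B * (ε / (2 * B)) := by
        gcongr
        linarith
    _ = ε / 2 := by field_simp
    _ < ε := half_lt_self hε

end MarkovProcess

end

/-! ### The theorem -/

theorem mainTheorem5 {E Ω : Type*} [MetricSpace E] [LocallyCompactSpace E]
    [MeasurableSpace E] [BorelSpace E] [MeasurableSpace Ω]
    (M : MarkovProcess E Ω) (f g : E → ℝ)
    (hf : Continuous f) (hf_bdd : ∃ C : ℝ, ∀ x, |f x| ≤ C) (hg : Continuous g)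
    (T : ℝ≥0) (hB : M.AssumptionB g T) :
    -- the stopping problems are well posed and their values `w_t(x)` are finite
    (∀ t ∈ Icc 0 T, ∀ x : E,
      (∀ τ ∈ M.stoppingTimes t, Integrable (M.reward f g τ) (M.P x)) ∧
        BddAbove (M.expectedRewards f g t x)) ∧
    -- `ŵ^n_t(x) → w_t(x)` uniformly on `[0, T] × K`, for each ball `K` as in `(B)_T`
    (∀ (x : E) (δ : ℝ), M.IsGoodBall g T x δ →
      TendstoUniformlyOn (fun (n : ℕ) (p : ℝ≥0 × E) => M.truncatedValue f g n p.1 p.2)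
        (fun p => M.value f g p.1 p.2) atTop (Icc 0 T ×ˢ Metric.closedBall x δ)) ∧
    -- under the weak Feller property `w` is jointly continuous on `[0, T] × E`
    (TopologicalSpace.SeparableSpace E → M.WeakFeller →
      ContinuousOn (fun p : ℝ≥0 × E => M.value f g p.1 p.2) (Icc 0 T ×ˢ univ)) := by
  obtain ⟨C, hC⟩ := hf_bdd
  refine ⟨fun t ht x => ?_, fun x δ hδ => ?_, fun hsep hM => ?_⟩
  · obtain ⟨δ, hδ, -, hK⟩ := hB x
    exact (MarkovProcess.wellPosed_of_supUniformlyIntegrableOn hf hC hg hK ht.2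
      (Metric.mem_closedBall_self hδ.le)).2
  · exact MarkovProcess.tendstoUniformlyOn_truncatedValue hf hC hg hδ.2.2
  · have : SecondCountableTopology E := UniformSpace.secondCountable_of_separable E
    have : FirstCountableTopology (OnePoint E) := firstCountableTopology_onePoint E
    let _ : MeasurableSpace (OnePoint E) := borel (OnePoint E)
    have : BorelSpace (OnePoint E) := ⟨rfl⟩
    rintro ⟨t, x⟩ ⟨ht, -⟩
    obtain ⟨δ, hδ, -, hK⟩ := hB x
    have hn : ∀ n, ContinuousOn (fun p : ℝ≥0 × E => M.truncatedValue f g n p.1 p.2)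
        (Icc 0 T ×ˢ Metric.closedBall x δ) := fun n =>
      (MarkovProcess.continuousOn_value_of_bound hM hf hC
        (MarkovProcess.continuous_truncation hg n)
        (MarkovProcess.abs_truncation_le g n) T).mono (prod_mono le_rfl (subset_univ _))
    -- Uniform convergence holds only ball by ball, but the ball is a neighbourhood of its centre x,
    -- so continuity on it gives continuity at (t, x) within [0, T] × E.
    have hc := (MarkovProcess.tendstoUniformlyOn_truncatedValue hf hC hg hK).continuousOn
      (Frequently.of_forall hn)
    refine (hc (t, x) ⟨ht, Metric.mem_closedBall_self hδ.le⟩).mono_of_mem_nhdsWithin ?_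
    rw [nhdsWithin_prod_eq, nhdsWithin_univ]
    exact prod_mem_prod self_mem_nhdsWithin (Metric.closedBall_mem_nhds x hδ)
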